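/- Let $K$ be a non-archimedean local field (for instance the completion of a number field at a maximal ideal of its ring of integers), with valuation ring $R_K$, residue field $\mathbb F_q$, absolute value $|z|_K=q^{-\mathrm{ord}(z)}$ ($\mathrm{ord}$ normalised so that uniformisers have order $1$), and Haar measure normalised by $\mathrm{vol}(R_K)=1$. Let $f=\sum_l c_l x^l\in R_K[x_1^{\pm1},x_2^{\pm1}]$ and let $\Gamma_\infty\subset\mathbb R^2$ be the convex hull of $\{l\in\mathbb Z^2: c_l\ne0\}$; assume $\dim\Gamma_\infty=2$. Proper faces of $\Gamma_\infty$ are its intersections with supporting lines. For $a\in\mathbb R^2$ put $d(a)=\min_{x\in\Gamma_\infty}\langle a,x\rangle$, $F(a)=\{x\in\Gamma_\infty:\langle a,x\rangle=d(a)\}$, $\|a\|=a_1+a_2$. For a face $\tau$ put $\Delta_\tau=\{a\in\mathbb R^2:F(a)=\tau\}$ and $f_\tau=\sum_{l\in\tau}c_lx^l$, and let $\overline{f_\tau}$ be the reduction of $f_\tau$ over $\mathbb F_q$. Let $\mathcal A$ be the (finite) set of attainable faces, i.e. proper faces $\tau$ with $\mathbb R_+^2\cap\Delta_\tau\neq\emptyset$,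 where $\mathbb R_+=[0,\infty)$. Assume that $f$ is non-degenerate with respect to $\Gamma_\infty$ over $\mathbb F_q$: for every face $\tau$ of $\Gamma_\infty$, including $\Gamma_\infty$ itself, the system $\overline{f_\tau}(x)=0$, $\nabla\overline{f_\tau}(x)=0$ has no solution in $(\mathbb F_q^\times)^2$. Let $\mathcal D$ be a simplicial polyhedral subdivision of $\mathbb R_+^2\setminus\{0\}$ subordinated to $\Gamma_\infty$, that is, a finite partition of $\mathbb R_+^2\setminus\{0\}$ into relatively open cones $\Delta=\{\sum_{j=1}^{r_\Delta}\lambda_ja_j:\lambda_j>0\}$, where $r_\Delta\in\{1,2\}$ and $a_1,\dots,a_{r_\Delta}\in\mathbb Z^2$ are linearly independent (the edges of $\Delta$), each cone being contained in $\Delta_\tau$ for some $\tau\in\mathcal A$. Let $\alpha$ be the minimum of $\|a\|/(-d(a))$ over all edges $a$ of cones of $\mathcal D$ with $d(a)<0$ ($\alpha=+\infty$ if there are none), and $\beta$ the maximum of $-1$ and of the numbers $\|a\|/(-d(a))$ over all edges $a$ with $d(a)>0$. Then for every $s\in\mathbb C$ with $\beta<\operatorname{Re}(s)<\alpha$ the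 integral $$Z^{(1)}(s,f)=\int_{(R_K\setminus\{0\})^2}|f(x)|_K^s\,|dx|$$ converges absolutely, and $$Z^{(1)}(s,f)=L_{\Gamma_\infty}(q^{-s})+\sum_{\tau\in\mathcal A}L_\tau(q^{-s})\,S_\tau(q^{-s}),$$ where, for $\tau\in\mathcal A$ and for $\tau=\Gamma_\infty$, $$L_\tau(q^{-s})=q^{-2}\left((q-1)^2-\frac{N_\tau(1-q^{-s})}{1-q^{-s-1}}\right),\qquad N_\tau=\operatorname{Card}\{x\in(\mathbb F_q^\times)^2:\overline{f_\tau}(x)=0\},$$ and, for $\tau\in\mathcal A$, $$S_\tau(q^{-s})=\sum_{\Delta\in\mathcal D,\ \Delta\subseteq\Delta_\tau}\frac{\Big(\sum_h q^{\|h\|+d(h)s}\Big)\,q^{-\sum_{j=1}^{r_\Delta}(\|a_j\|+d(a_j)s)}}{\prod_{j=1}^{r_\Delta}\big(1-q^{-\|a_j\|-d(a_j)s}\big)},$$ in which, for the cone $\Delta$ with edges $a_1,\dots,a_{r_\Delta}$, $h$ runs through $\mathbb Z^2\cap\{\sum_{j=1}^{r_\Delta}\lambda_ja_j:0\le\lambda_j<1\}$.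 -/

import Mathlib

open MeasureTheory
open scoped ValuativeRel AddMonoidAlgebra

noncomputable section

namespace LaurentZeta

/-! ### Plane convex geometry: supporting lines, faces, the function `d`, cones -/

/-- The usual inner product of `ℝ²`. -/
def pair (a x : ℝ × ℝ) : ℝ := a.1 * x.1 + a.2 * x.2

/-- The inclusion of `ℤ²` in `ℝ²`. -/
def toReal (m : ℤ × ℤ) : ℝ × ℝ := ((m.1 : ℝ), (m.2 : ℝ))

/-- `‖a‖ = a₁ + a₂`. -/
def weight (a : ℤ × ℤ) : ℤ := a.1 + a.2

/-- The line `⟨a, x⟩ = b` is a supporting line of `Γ`. -/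
def IsSupportingLine (Γ : Set (ℝ × ℝ)) (a : ℝ × ℝ) (b : ℝ) : Prop :=
  a ≠ 0 ∧ (∃ x ∈ Γ, pair a x = b) ∧ ((∀ x ∈ Γ, b ≤ pair a x) ∨ (∀ x ∈ Γ, pair a x ≤ b))

/-- The proper faces of `Γ` (in dimension two): intersections with supporting lines. -/
def IsProperFace (Γ τ : Set (ℝ × ℝ)) : Prop :=
  ∃ a b, IsSupportingLine Γ a b ∧ τ = {x ∈ Γ | pair a x = b}

/-- `d(a) = inf {⟨a, x⟩ : x ∈ Γ}`. -/
def dist (Γ : Set (ℝ × ℝ)) (a : ℝ × ℝ) : ℝ := sInf (pair a '' Γ)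

/-- The first meet locus `F(a)`. -/
def meetLocus (Γ : Set (ℝ × ℝ)) (a : ℝ × ℝ) : Set (ℝ × ℝ) := {x ∈ Γ | pair a x = dist Γ a}

/-- The cone `Δ_τ = {a : F(a) = τ}` associated to a face `τ`. -/
def faceCone (Γ τ : Set (ℝ × ℝ)) : Set (ℝ × ℝ) := {a | meetLocus Γ a = τ}

/-- The closed first quadrant `ℝ₊²`. -/
def quadrant : Set (ℝ × ℝ) := {x | 0 ≤ x.1 ∧ 0 ≤ x.2}

/-- The set of attainable faces of `Γ`: the proper faces `τ` such that `Δ_τ` meets `ℝ₊²`. -/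
def attainable (Γ : Set (ℝ × ℝ)) : Set (Set (ℝ × ℝ)) :=
  {τ | IsProperFace Γ τ ∧ (quadrant ∩ faceCone Γ τ).Nonempty}

/-- The relatively open cone spanned by a finite set `g` of integral generators. -/
def openCone (g : Finset (ℤ × ℤ)) : Set (ℝ × ℝ) :=
  {x | ∃ c : ℤ × ℤ → ℝ, (∀ a ∈ g, 0 < c a) ∧ x = ∑ a ∈ g, c a • toReal a}

/-- The lattice points of the half-open fundamental parallelogram spanned by `g`. -/
def latticePoints (g : Finset (ℤ × ℤ)) : Set (ℤ × ℤ) :=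
  {h | ∃ c : ℤ × ℤ → ℝ, (∀ a ∈ g, 0 ≤ c a ∧ c a < 1) ∧ toReal h = ∑ a ∈ g, c a • toReal a}

/-- `D` (a finite family of sets of generators) is a simplicial polyhedral subdivision of
`ℝ₊² \ {0}` subordinated to `Γ`: the relatively open rational simplicial cones spanned by the
members of `D` (rays and two-dimensional cones) form a partition of `ℝ₊² \ {0}`, and each of them
is contained in the cone `Δ_τ` of some attainable face `τ`. -/
structure IsSubdivision (Γ : Set (ℝ × ℝ)) (D : Finset (Finset (ℤ × ℤ))) : Prop where
  nonempty : ∀ g ∈ D, g.Nonempty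
  simplicial : ∀ g ∈ D, LinearIndependent ℝ (fun a : {a // a ∈ g} => toReal a)
  subset : ∀ g ∈ D, openCone g ⊆ quadrant \ {0}
  disjoint : ∀ g ∈ D, ∀ g' ∈ D, g ≠ g' → Disjoint (openCone g) (openCone g')
  cover : ∀ x ∈ quadrant \ {0}, ∃ g ∈ D, x ∈ openCone g
  subordinated : ∀ g ∈ D, ∃ τ ∈ attainable Γ, openCone g ⊆ faceCone Γ τ

/-- The abscissa `α`: the minimum of `‖a‖ / (-d(a))` over the edges `a` with `d(a) < 0`,
and `+∞` if there is no such edge. -/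
def alpha (Γ : Set (ℝ × ℝ)) (D : Finset (Finset (ℤ × ℤ))) : EReal :=
  ⨅ g ∈ D, ⨅ a ∈ g, ⨅ _ : dist Γ (toReal a) < 0,
    (((weight a : ℝ) / (-dist Γ (toReal a)) : ℝ) : EReal)

/-- The abscissa `β`: the maximum of `-1` and of the numbers `‖a‖ / (-d(a))` over the edges `a`
with `d(a) > 0`. -/
def beta (Γ : Set (ℝ × ℝ)) (D : Finset (Finset (ℤ × ℤ))) : EReal :=
  max ((-1 : ℝ) : EReal) (⨆ g ∈ D, ⨆ a ∈ g, ⨆ _ : 0 < dist Γ (toReal a),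
    (((weight a : ℝ) / (-dist Γ (toReal a)) : ℝ) : EReal))

/-- The exponent `‖a‖ + d(a) s`. -/
def expo (Γ : Set (ℝ × ℝ)) (s : ℂ) (a : ℤ × ℤ) : ℂ :=
  (weight a : ℂ) + (dist Γ (toReal a) : ℂ) * s

/-- The generating sum of the cone spanned by `g`. -/
def coneSum (Γ : Set (ℝ × ℝ)) (q : ℕ) (s : ℂ) (g : Finset (ℤ × ℤ)) : ℂ :=
  ((∑ᶠ h ∈ latticePoints g, (q : ℂ) ^ expo Γ s h) * (q : ℂ) ^ (-∑ a ∈ g, expo Γ s a)) /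
    ∏ a ∈ g, (1 - (q : ℂ) ^ (-expo Γ s a))

open Classical in
/-- `S_τ(q^{-s})`: the sum of the generating sums of the cones of the subdivision that lie in
`Δ_τ`. -/
def S (Γ : Set (ℝ × ℝ)) (D : Finset (Finset (ℤ × ℤ))) (q : ℕ) (s : ℂ) (τ : Set (ℝ × ℝ)) : ℂ :=
  ∑ g ∈ D with openCone g ⊆ faceCone Γ τ, coneSum Γ q s g

/-! ### Laurent polynomials in two variables -/

section Laurent

/-- The value of a Laurent polynomial at a point of the torus. -/
def eval {F : Type*} [Field F] (g : F[ℤ × ℤ]) (x : F × F) : F :=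
  g.coeff.sum fun m c => c * x.1 ^ m.1 * x.2 ^ m.2

/-- The partial derivative in the first variable. -/
def pderivFst {F : Type*} [Field F] (g : F[ℤ × ℤ]) : F[ℤ × ℤ] :=
  g.coeff.sum fun m c => AddMonoidAlgebra.single (m - (1, 0)) ((m.1 : F) * c)

/-- The partial derivative in the second variable. -/
def pderivSnd {F : Type*} [Field F] (g : F[ℤ × ℤ]) : F[ℤ × ℤ] :=
  g.coeff.sum fun m c => AddMonoidAlgebra.single (m - (0, 1)) ((m.2 : F) * c)

/-- The Newton polytope at infinity: the convex hull of the support. -/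
def newton {R : Type*} [CommRing R] (f : R[ℤ × ℤ]) : Set (ℝ × ℝ) :=
  convexHull ℝ (toReal '' (f.coeff.support : Set (ℤ × ℤ)))

open Classical in
/-- The face function `f_τ`. -/
def faceFun {R : Type*} [CommRing R] (f : R[ℤ × ℤ]) (τ : Set (ℝ × ℝ)) : R[ℤ × ℤ] :=
  AddMonoidAlgebra.ofCoeff (f.coeff.filter fun m => toReal m ∈ τ)

end Laurent

/-! ### Local fields -/

section LocalField

variable (K : Type*) [Field K] [ValuativeRel K] [TopologicalSpace K]
  [IsNonarchimedeanLocalField K]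

/-- The cardinality of the residue field. -/
def q : ℕ := Nat.card 𝓀[K]

variable {K}

/-- The valuation `ord`, normalised so that a uniformiser has order `1` (junk at `0`). -/
def ord (z : K) : ℤ :=
  -WithZero.log (IsNonarchimedeanLocalField.valueGroupWithZeroIsoInt K
    (ValuativeRel.valuation K z))

open Classical in
/-- The normalised absolute value `|z|_K = q^{-ord z}`. -/
def absK (z : K) : ℝ := if z = 0 then 0 else (q K : ℝ) ^ (-ord z)

/-- The reduction `\bar{f_τ}` of the face function modulo the maximal ideal. -/
def redFace (f : 𝒪[K][ℤ × ℤ]) (τ : Set (ℝ × ℝ)) : 𝓀[K][ℤ × ℤ] :=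
  AddMonoidAlgebra.mapRingHom (ℤ × ℤ) (IsLocalRing.residue 𝒪[K]) (faceFun f τ)

/-- `f` is non-degenerate with respect to its Newton polytope over the residue field: for every
face `τ`, including the polytope itself, the reduction of `f_τ` has no singular zeros in the
torus over the residue field. -/
def NonDegenerate (f : 𝒪[K][ℤ × ℤ]) : Prop :=
  ∀ τ, (τ = newton f ∨ IsProperFace (newton f) τ) →
    ∀ x : 𝓀[K] × 𝓀[K], x.1 ≠ 0 → x.2 ≠ 0 →
      ¬ (eval (redFace f τ) x = 0 ∧ eval (pderivFst (redFace f τ)) x = 0 ∧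
        eval (pderivSnd (redFace f τ)) x = 0)

/-- `N_τ`: the number of zeros of the reduction of `f_τ` in the torus over the residue field. -/
def N (f : 𝒪[K][ℤ × ℤ]) (τ : Set (ℝ × ℝ)) : ℕ :=
  Nat.card {x : 𝓀[K] × 𝓀[K] // x.1 ≠ 0 ∧ x.2 ≠ 0 ∧ eval (redFace f τ) x = 0}

/-- `L_τ(q^{-s})`. -/
def L (f : 𝒪[K][ℤ × ℤ]) (s : ℂ) (τ : Set (ℝ × ℝ)) : ℂ :=
  (q K : ℂ) ^ (-2 : ℤ) * (((q K : ℂ) - 1) ^ 2 -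
    (N f τ : ℂ) * (1 - (q K : ℂ) ^ (-s)) / (1 - (q K : ℂ) ^ (-s - 1)))

variable (K) in
/-- The domain of integration `(R_K \ {0})²`. -/
def integralTorus : Set (K × K) := {x | x.1 ∈ 𝒪[K] ∧ x.2 ∈ 𝒪[K] ∧ x.1 ≠ 0 ∧ x.2 ≠ 0}

/-- The integrand `|f(x)|_K^s`. -/
def integrand (f : 𝒪[K][ℤ × ℤ]) (s : ℂ) (x : K × K) : ℂ :=
  (absK (eval (AddMonoidAlgebra.mapRingHom (ℤ × ℤ) 𝒪[K].subtype f) x) : ℂ) ^ s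

/-- The local zeta function `Z^{(1)}(s, f)`; `μ` is the normalised Haar measure of `K`. -/
def zeta [MeasurableSpace K] (μ : Measure K) (f : 𝒪[K][ℤ × ℤ]) (s : ℂ) : ℂ :=
  ∫ x in integralTorus K, integrand f s x ∂(μ.prod μ)

end LocalField

end LaurentZeta

end

/-! The domain is cut according to the order vector `a = (ord x₁, ord x₂)`, which runs over the
lattice points of the quadrant. For a uniformizer `p`, substitute `x = p^a u` with `u` in the unit
torus. This contributes the Jacobian `q^(-‖a‖)`, and `f(p^a u) = p^(d(a)) g_a(u)`, where `g_a` has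
integral coefficients and reduces to the face function of `F(a)`. This is
`scaledCoeff_mem_residueClass` together with `polyFun_scale`.

Non-degeneracy makes every torus zero of the reduction smooth. On the residue class of such a zero,
with one coordinate fixed, `g_a` is an isometry in the other, so the set `ord g_a ≥ k` has measure
`N q^(-k-1)` for `k ≥ 1` (`measure_unitLevel_succ`). For `k = 0` the measure is `(1 - 1/q)²`.
Summing over the exact order of `g_a`, a geometric series that converges because `Re s > -1`, gives
`L` at `F(a)` (`hasSum_shell_terms`). Hence the integral is the sum over `a` of `q^(-‖a‖-d(a)s)
L_{F(a)}`.

The term `a = 0` has `F(0) = Γ` and is the isolated summand. The remaining `a` are distributed among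
the cones of the subdivision. On an open cone `F` is constant, and `d` is linear on its closure
(`exists_dist_eq_pair_on_cone`). Each lattice point of the cone is uniquely `∑ (kᵢ + 1) aᵢ - h`,
with `kᵢ ≥ 0` and `h` in the half-open parallelogram (`bijective_conePoint`), so the sum is a finite
sum times geometric series. Their ratios have modulus below one exactly when `‖aᵢ‖ + d(aᵢ) Re s >
0`, which the bounds `α` and `β` guarantee (`expo_re_pos`).

Absolute convergence comes along: the integrand is constant on each set where `a` and the order of
`f` are fixed, so the same double series of norms controls its integral. -/

noncomputable section

namespace LaurentZeta

open ValuativeRel Pointwise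
open scoped WithZero

/-! ### Valuation, balls and Haar measure of a local field -/

section LocalFieldMeasure

/-- A rank one valuation makes `K` a normed field, and local compactness makes it proper, hence
second countable. This supplies joint measurability of the ring operations and σ-finiteness for
product measures. -/
theorem t2Space_and_secondCountable (K : Type*) [Field K] [ValuativeRel K] [TopologicalSpace K]
    [IsNonarchimedeanLocalField K] : T2Space K ∧ SecondCountableTopology K := by
  let _ := IsTopologicalAddGroup.rightUniformSpace K
  have := isUniformAddGroup_of_addCommGroup (G := K)
  let _ : (Valued.v (R := K)).RankOne :=
  { hom' := IsRankLeOne.nonempty.some.emb (R := K).comp MonoidWithZeroHom.ValueGroup₀.embedding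
    strictMono' := IsRankLeOne.nonempty.some.strictMono.comp
        MonoidWithZeroHom.ValueGroup₀.embedding_strictMono }
  open scoped Valued in
  have : ProperSpace K := .of_nontriviallyNormedField_of_weaklyLocallyCompactSpace K
  open scoped Valued in
  exact ⟨inferInstance, secondCountable_of_proper⟩

variable {K : Type*} [Field K] [ValuativeRel K] [TopologicalSpace K]
  [IsNonarchimedeanLocalField K]

instance : T2Space K := (t2Space_and_secondCountable K).1

instance : SecondCountableTopology K := (t2Space_and_secondCountable K).2

variable (K) in
/-- The canonical valuation of a local field, with values in `ℤᵐ⁰`. -/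
def val : Valuation K ℤᵐ⁰ :=
  (valuation K).map
    { toFun := IsNonarchimedeanLocalField.valueGroupWithZeroIsoInt K
      map_zero' := map_zero _
      map_one' := map_one _
      map_mul' := map_mul _ }
    (IsNonarchimedeanLocalField.valueGroupWithZeroIsoInt K).strictMono.monotone

theorem val_apply (x : K) :
    val K x = IsNonarchimedeanLocalField.valueGroupWithZeroIsoInt K (valuation K x) := rfl

theorem val_le_val_iff {x y : K} : val K x ≤ val K y ↔ valuation K x ≤ valuation K y := by
  simp [val_apply]

theorem val_surjective : Function.Surjective (val K) :=
  (IsNonarchimedeanLocalField.valueGroupWithZeroIsoInt K).surjective.comp valuation_surjective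

theorem val_eq_exp {x : K} (hx : x ≠ 0) : val K x = WithZero.exp (-ord x) := by
  rw [ord, neg_neg, ← val_apply, WithZero.exp_log ((val K).ne_zero_iff.2 hx)]

theorem ne_zero_of_val_eq_exp {x : K} {n : ℤ} (h : val K x = WithZero.exp n) : x ≠ 0 :=
  (val K).ne_zero_iff.1 (h ▸ WithZero.exp_ne_zero)

theorem val_le_one_iff {x : K} : val K x ≤ 1 ↔ x ∈ 𝒪[K] := by
  rw [Valuation.mem_integer_iff, ← map_one (val K), ← map_one (valuation K), val_le_val_iff]

theorem val_lt_one_iff (x : 𝒪[K]) : val K (x : K) < 1 ↔ IsLocalRing.residue 𝒪[K] x = 0 := by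
  rw [IsLocalRing.residue_eq_zero_iff, IsLocalRing.mem_maximalIdeal, mem_nonunits_iff,
    Valuation.Integers.isUnit_iff_valuation_eq_one (Valuation.integer.integers (valuation K)),
    lt_iff_le_and_ne]
  have h1 : val K (x : K) ≤ 1 := val_le_one_iff.2 x.2
  have : val K (x : K) = 1 ↔ valuation K (x : K) = 1 := by
    rw [val_apply, EmbeddingLike.map_eq_one_iff]
  simp only [h1, true_and, ne_eq, this]
  rfl

theorem val_eq_one_iff (x : 𝒪[K]) : val K (x : K) = 1 ↔ IsLocalRing.residue 𝒪[K] x ≠ 0 := by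
  rw [ne_eq, ← val_lt_one_iff, not_lt]
  exact ⟨fun h => h.ge, fun h => le_antisymm (val_le_one_iff.2 x.2) h⟩

theorem lt_exp_iff_le {x : ℤᵐ⁰} {n : ℤ} : x < WithZero.exp n ↔ x ≤ WithZero.exp (n - 1) := by
  rw [← WithZero.lt_mul_exp_iff_le WithZero.exp_ne_zero, ← WithZero.exp_add, sub_add_cancel]

theorem lt_one_iff_le_exp {x : ℤᵐ⁰} : x < 1 ↔ x ≤ WithZero.exp (-1) := by
  rw [← WithZero.exp_zero, lt_exp_iff_le, zero_sub]

theorem q_eq_natCard : q K = Nat.card 𝓀[K] := rfl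

theorem one_lt_q : 1 < q K := Finite.one_lt_card

theorem q_pos : (0 : ℝ) < q K := by
  have := one_lt_q (K := K)
  positivity

variable (K) in
theorem exists_uniformizer : ∃ p : K, val K p = WithZero.exp (-1) := val_surjective _

/-- The closed ball `{x | ord x ≥ k}`. -/
def ball (K : Type*) [Field K] [ValuativeRel K] [TopologicalSpace K]
    [IsNonarchimedeanLocalField K] (k : ℤ) : Set K := {x | val K x ≤ WithZero.exp (-k)}

theorem mem_ball {k : ℤ} {x : K} : x ∈ ball K k ↔ val K x ≤ WithZero.exp (-k) := Iff.rfl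

theorem ball_antitone {j k : ℤ} (h : j ≤ k) : ball K k ⊆ ball K j := by
  intro x hx
  rw [mem_ball] at hx ⊢
  refine hx.trans ?_
  rw [WithZero.exp_le_exp]
  linarith

theorem ball_zero : ball K 0 = (𝒪[K] : Set K) := by
  ext x
  simp [ball, ← val_le_one_iff]

variable [MeasurableSpace K] [BorelSpace K]

theorem measurableSet_ball (k : ℤ) : MeasurableSet (ball K k) := by
  refine (IsCompact.isClosed ?_).measurableSet
  convert IsNonarchimedeanLocalField.isCompact_closedBall K
    ((IsNonarchimedeanLocalField.valueGroupWithZeroIsoInt K).symm (WithZero.exp (-k))) using 1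
  ext x
  change val K x ≤ _ ↔ valuation K x ≤ _
  rw [val_apply, ← map_le_map_iff (IsNonarchimedeanLocalField.valueGroupWithZeroIsoInt K)
    (a := valuation K x)]
  simp

/-- The residue class of `r` in the valuation ring, as a subset of the field. -/
def residueClass (r : 𝓀[K]) : Set K :=
  {x | ∃ h : x ∈ 𝒪[K], IsLocalRing.residue 𝒪[K] ⟨x, h⟩ = r}

omit [MeasurableSpace K] [BorelSpace K] in
theorem mem_residueClass_iff (x₀ : 𝒪[K]) (x : K) :
    x ∈ residueClass (IsLocalRing.residue 𝒪[K] x₀) ↔ val K (x - x₀) < 1 := by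
  constructor
  · rintro ⟨h, hx⟩
    rw [← sub_eq_zero, ← map_sub, ← val_lt_one_iff] at hx
    exact hx
  · intro h
    have hx : x ∈ 𝒪[K] := by
      have := add_mem (val_le_one_iff.1 h.le) x₀.2
      simpa using this
    refine ⟨hx, ?_⟩
    rw [← sub_eq_zero, ← map_sub, ← val_lt_one_iff]
    exact h

omit [MeasurableSpace K] [BorelSpace K] in
theorem residueClass_eq_preimage (x₀ : 𝒪[K]) :
    residueClass (IsLocalRing.residue 𝒪[K] x₀) = (fun x => -(x₀ : K) + x) ⁻¹' ball K 1 := by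
  ext x
  rw [mem_residueClass_iff, lt_one_iff_le_exp, sub_eq_neg_add]
  rfl

theorem measurableSet_residueClass (r : 𝓀[K]) : MeasurableSet (residueClass r) := by
  obtain ⟨x₀, rfl⟩ := IsLocalRing.residue_surjective r
  rw [residueClass_eq_preimage]
  exact (measurable_const_add _) (measurableSet_ball 1)

omit [MeasurableSpace K] [BorelSpace K] in
theorem pairwise_disjoint_residueClass :
    Pairwise (Function.onFun Disjoint (residueClass (K := K))) := by
  intro r s hrs
  rw [Function.onFun, Set.disjoint_left]
  rintro x ⟨h, hr⟩ ⟨h', hs⟩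
  exact hrs (hr.symm.trans hs)

omit [MeasurableSpace K] [BorelSpace K] in
theorem iUnion_residueClass : ⋃ r, residueClass (K := K) r = (𝒪[K] : Set K) := by
  ext x
  simp only [residueClass, Set.mem_iUnion]
  exact ⟨fun ⟨r, h, _⟩ => h, fun h => ⟨_, h, rfl⟩⟩

variable (μ : Measure K) [μ.IsAddHaarMeasure]

theorem measure_residueClass_eq_ball (r : 𝓀[K]) : μ (residueClass r) = μ (ball K 1) := by
  obtain ⟨x₀, rfl⟩ := IsLocalRing.residue_surjective r
  rw [residueClass_eq_preimage, measure_preimage_add]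

variable {μ}

/-- The valuation ring is the disjoint union of `q` residue classes, all translates of the maximal
ideal. -/
theorem measure_ball_one (hμ : μ (𝒪[K] : Set K) = 1) :
    μ (ball K 1) = ENNReal.ofReal ((q K : ℝ)⁻¹) := by
  rw [← iUnion_residueClass, measure_iUnion pairwise_disjoint_residueClass
    measurableSet_residueClass] at hμ
  have := Fintype.ofFinite 𝓀[K]
  simp only [measure_residueClass_eq_ball, tsum_fintype, Finset.sum_const, Finset.card_univ,
    nsmul_eq_mul] at hμ
  rw [← Nat.card_eq_fintype_card, ← q_eq_natCard] at hμ
  rw [ENNReal.ofReal_inv_of_pos q_pos, ENNReal.ofReal_natCast]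
  exact (ENNReal.eq_inv_of_mul_eq_one_left ((mul_comm _ _).trans hμ))

omit [MeasurableSpace K] [BorelSpace K] in
theorem smul_ball (u : Kˣ) (n k : ℤ) (hu : val K (u : K) = WithZero.exp (-n)) :
    u • ball K k = ball K (n + k) := by
  ext x
  rw [Set.mem_smul_set_iff_inv_smul_mem]
  change val K (((u⁻¹ : Kˣ) : K) * x) ≤ _ ↔ val K x ≤ _
  rw [Units.val_inv_eq_inv_val, map_mul, map_inv₀, hu, inv_mul_le_iff₀ WithZero.exp_pos,
    ← WithZero.exp_add, neg_add]

theorem distribHaarChar_of_val_eq_exp_zero (u : Kˣ) (hu : val K (u : K) = 1)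
    (hμ : μ (𝒪[K] : Set K) = 1) : distribHaarChar K u = 1 := by
  refine distribHaarChar_eq_of_measure_smul_eq_mul (μ := μ) (s := 𝒪[K]) (by simp [hμ])
    (by simp [hμ]) ?_
  rw [← ball_zero, smul_ball u 0 0 (by simpa using hu)]
  simp

theorem distribHaarChar_uniformizer (u : Kˣ) (hu : val K (u : K) = WithZero.exp (-1))
    (hμ : μ (𝒪[K] : Set K) = 1) : distribHaarChar K u = (q K : NNReal)⁻¹ := by
  refine distribHaarChar_eq_of_measure_smul_eq_mul (μ := μ) (s := 𝒪[K]) (by simp [hμ])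
    (by simp [hμ]) ?_
  rw [hμ, ← ball_zero, smul_ball u 1 0 hu, add_zero, measure_ball_one hμ, mul_one,
    ENNReal.ofReal_inv_of_pos q_pos, ENNReal.coe_inv]
  · simp
  · have := one_lt_q (K := K)
    positivity

/-- By multiplicativity it suffices to know the modulus of a unit, which preserves the valuation
ring, and of a uniformizer, which maps it onto `ball K 1`. -/
theorem distribHaarChar_eq_zpow (u : Kˣ) (n : ℤ) (hu : val K (u : K) = WithZero.exp (-n))
    (hμ : μ (𝒪[K] : Set K) = 1) : distribHaarChar K u = (q K : NNReal) ^ (-n) := by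
  obtain ⟨p, hp⟩ := exists_uniformizer K
  have hp0 : p ≠ 0 := ne_zero_of_val_eq_exp hp
  have h1 := distribHaarChar_of_val_eq_exp_zero (μ := μ) (u * (Units.mk0 p hp0) ^ (-n))
    (by simp [hu, hp, ← WithZero.exp_zsmul, ← WithZero.exp_neg, ← WithZero.exp_add]) hμ
  rw [map_mul, map_zpow, distribHaarChar_uniformizer (Units.mk0 p hp0) hp hμ] at h1
  rw [eq_comm]
  have hq : (q K : NNReal) ≠ 0 := by
    have := one_lt_q (K := K)
    positivity
  rw [inv_zpow', neg_neg] at h1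
  rw [zpow_neg]
  exact (eq_inv_of_mul_eq_one_left h1).symm

theorem measure_smul (u : Kˣ) (n : ℤ) (hu : val K (u : K) = WithZero.exp (-n))
    (hμ : μ (𝒪[K] : Set K) = 1) (s : Set K) :
    μ (u • s) = ENNReal.ofReal ((q K : ℝ) ^ (-n)) * μ s := by
  rw [← distribHaarChar_mul, distribHaarChar_eq_zpow u n hu hμ, ENNReal.ofReal]
  congr 3
  rw [Real.toNNReal_of_nonneg (by positivity)]
  ext
  simp

theorem measure_ball (hμ : μ (𝒪[K] : Set K) = 1) (k : ℤ) :
    μ (ball K k) = ENNReal.ofReal ((q K : ℝ) ^ (-k)) := by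
  obtain ⟨p, hp⟩ := val_surjective (K := K) (WithZero.exp (-k))
  have hp0 : p ≠ 0 := ne_zero_of_val_eq_exp hp
  have := smul_ball (Units.mk0 p hp0) k 0 hp
  rw [add_zero] at this
  rw [← this, measure_smul _ k hp hμ, ball_zero, hμ, mul_one]

theorem map_mul_left_measure {p : K} {n : ℤ} (hp : val K p = WithZero.exp (-n))
    (hμ : μ (𝒪[K] : Set K) = 1) :
    μ.map (fun x => p⁻¹ * x) = ENNReal.ofReal ((q K : ℝ) ^ (-n)) • μ := by
  have hp0 : p ≠ 0 := ne_zero_of_val_eq_exp hp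
  ext s hs
  rw [Measure.map_apply (measurable_const_mul _) hs, Measure.smul_apply, smul_eq_mul,
    ← measure_smul (Units.mk0 p hp0) n hp hμ]
  congr 1
  ext x
  rw [Set.mem_smul_set_iff_inv_smul_mem]
  simp [Units.smul_def]

/-- Scaling of measures of subsets of the plane. -/
theorem prod_measure_preimage_scale {p₁ p₂ : K} {n₁ n₂ : ℤ} (hp₁ : val K p₁ = WithZero.exp (-n₁))
    (hp₂ : val K p₂ = WithZero.exp (-n₂)) (hμ : μ (𝒪[K] : Set K) = 1) {s : Set (K × K)}
    (hs : MeasurableSet s) :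
    (μ.prod μ) ((fun x : K × K => (p₁⁻¹ * x.1, p₂⁻¹ * x.2)) ⁻¹' s) =
      ENNReal.ofReal ((q K : ℝ) ^ (-(n₁ + n₂))) * (μ.prod μ) s := by
  have h := Measure.map_prod_map μ μ (measurable_const_mul p₁⁻¹) (measurable_const_mul p₂⁻¹)
  rw [map_mul_left_measure hp₁ hμ, map_mul_left_measure hp₂ hμ] at h
  have h2 := congrArg (fun m => m s) h
  rw [Measure.map_apply (by fun_prop) hs, Measure.prod_smul_left, Measure.prod_smul_right,
    Measure.smul_apply, Measure.smul_apply, smul_eq_mul, smul_eq_mul, ← mul_assoc,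
    ← ENNReal.ofReal_mul (by positivity), ← zpow_add₀ q_pos.ne', ← neg_add] at h2
  exact h2.symm

end LocalFieldMeasure

/-- The value at `x` of the Laurent polynomial with coefficients `C` and exponents in `S`. -/
def laurent {F : Type*} [Field F] (S : Finset (ℤ × ℤ)) (C : ℤ × ℤ → F) (x : F × F) : F :=
  ∑ m ∈ S, C m * x.1 ^ m.1 * x.2 ^ m.2

/-- The first partial derivative of `laurent S C` at `x`. -/
def laurentFst {F : Type*} [Field F] (S : Finset (ℤ × ℤ)) (C : ℤ × ℤ → F) (x : F × F) : F :=
  ∑ m ∈ S, C m * (m.1 * x.1 ^ (m.1 - 1)) * x.2 ^ m.2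

/-- The second partial derivative of `laurent S C` at `x`. -/
def laurentSnd {F : Type*} [Field F] (S : Finset (ℤ × ℤ)) (C : ℤ × ℤ → F) (x : F × F) : F :=
  ∑ m ∈ S, C m * x.1 ^ m.1 * (m.2 * x.2 ^ (m.2 - 1))

/-! ### Reduction of Laurent polynomials and a Hensel-type argument -/

section ResidueClass

variable {K : Type*} [Field K] [ValuativeRel K] [TopologicalSpace K]
  [IsNonarchimedeanLocalField K]

theorem add_mem_residueClass {x y : K} {r s : 𝓀[K]} (hx : x ∈ residueClass r)
    (hy : y ∈ residueClass s) : x + y ∈ residueClass (r + s) := by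
  obtain ⟨hx, rfl⟩ := hx
  obtain ⟨hy, rfl⟩ := hy
  exact ⟨add_mem hx hy, map_add _ (⟨x, hx⟩ : 𝒪[K]) ⟨y, hy⟩⟩

theorem mul_mem_residueClass {x y : K} {r s : 𝓀[K]} (hx : x ∈ residueClass r)
    (hy : y ∈ residueClass s) : x * y ∈ residueClass (r * s) := by
  obtain ⟨hx, rfl⟩ := hx
  obtain ⟨hy, rfl⟩ := hy
  exact ⟨mul_mem hx hy, map_mul _ (⟨x, hx⟩ : 𝒪[K]) ⟨y, hy⟩⟩

theorem neg_mem_residueClass {x : K} {r : 𝓀[K]} (hx : x ∈ residueClass r) :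
    -x ∈ residueClass (-r) := by
  obtain ⟨hx, rfl⟩ := hx
  exact ⟨neg_mem hx, map_neg _ (⟨x, hx⟩ : 𝒪[K])⟩

theorem sub_mem_residueClass {x y : K} {r s : 𝓀[K]} (hx : x ∈ residueClass r)
    (hy : y ∈ residueClass s) : x - y ∈ residueClass (r - s) := by
  rw [sub_eq_add_neg, sub_eq_add_neg]
  exact add_mem_residueClass hx (neg_mem_residueClass hy)

theorem zero_mem_residueClass : (0 : K) ∈ residueClass (0 : 𝓀[K]) := ⟨zero_mem _, map_zero _⟩

theorem one_mem_residueClass : (1 : K) ∈ residueClass (1 : 𝓀[K]) := ⟨one_mem _, map_one _⟩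

theorem residueClass_zero : residueClass (0 : 𝓀[K]) = ball K 1 := by
  have := residueClass_eq_preimage (0 : 𝒪[K])
  simpa using this

theorem val_eq_one_iff_residueClass {x : K} : val K x = 1 ↔ ∃ r ≠ 0, x ∈ residueClass r := by
  constructor
  · intro h
    refine ⟨_, ?_, val_le_one_iff.1 h.le, rfl⟩
    rw [← val_eq_one_iff]
    exact h
  · rintro ⟨r, hr, hx, rfl⟩
    exact (val_eq_one_iff _).2 hr

theorem ne_zero_of_mem_residueClass {x : K} {r : 𝓀[K]} (hr : r ≠ 0) (hx : x ∈ residueClass r) :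
    x ≠ 0 := by
  rintro rfl
  have := val_eq_one_iff_residueClass.2 ⟨r, hr, hx⟩
  simp at this

theorem eq_of_mem_residueClass {x : K} {r s : 𝓀[K]} (hr : x ∈ residueClass r)
    (hs : x ∈ residueClass s) : r = s := by
  obtain ⟨_, rfl⟩ := hr
  obtain ⟨_, rfl⟩ := hs
  rfl

theorem inv_mem_residueClass {x : K} {r : 𝓀[K]} (hr : r ≠ 0) (hx : x ∈ residueClass r) :
    x⁻¹ ∈ residueClass r⁻¹ := by
  have h1 : val K x = 1 := val_eq_one_iff_residueClass.2 ⟨r, hr, hx⟩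
  have h2 : val K x⁻¹ = 1 := by rw [map_inv₀, h1, inv_one]
  obtain ⟨s, hs, hxs⟩ := val_eq_one_iff_residueClass.1 h2
  have h3 := mul_mem_residueClass hx hxs
  rw [mul_inv_cancel₀ (ne_zero_of_mem_residueClass hr hx)] at h3
  rwa [inv_eq_of_mul_eq_one_right (eq_of_mem_residueClass h3 one_mem_residueClass)]

theorem zpow_mem_residueClass {x : K} {r : 𝓀[K]} (hr : r ≠ 0) (hx : x ∈ residueClass r) (n : ℤ) :
    x ^ n ∈ residueClass (r ^ n) := by
  induction n with
  | zero => simpa using one_mem_residueClass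
  | succ n ih =>
    rw [zpow_add_one₀ hr, zpow_add_one₀ (ne_zero_of_mem_residueClass hr hx)]
    exact mul_mem_residueClass ih hx
  | pred n ih =>
    rw [zpow_sub_one₀ hr, zpow_sub_one₀ (ne_zero_of_mem_residueClass hr hx)]
    exact mul_mem_residueClass ih (inv_mem_residueClass hr hx)

theorem sum_mem_residueClass {ι : Type*} (S : Finset ι) {g : ι → K} {r : ι → 𝓀[K]}
    (h : ∀ i ∈ S, g i ∈ residueClass (r i)) : ∑ i ∈ S, g i ∈ residueClass (∑ i ∈ S, r i) := by
  classical
  induction S using Finset.induction_on with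
  | empty => simpa using zero_mem_residueClass
  | insert a S ha ih =>
    rw [Finset.sum_insert ha, Finset.sum_insert ha]
    exact add_mem_residueClass (h a (Finset.mem_insert_self _ _))
      (ih fun i hi => h i (Finset.mem_insert_of_mem hi))

theorem laurent_mem_residueClass {S : Finset (ℤ × ℤ)} {C : ℤ × ℤ → K} {c : ℤ × ℤ → 𝓀[K]}
    (hC : ∀ m ∈ S, C m ∈ residueClass (c m)) {x : K × K} {r : 𝓀[K] × 𝓀[K]} (h1 : r.1 ≠ 0)
    (h2 : r.2 ≠ 0) (hx1 : x.1 ∈ residueClass r.1) (hx2 : x.2 ∈ residueClass r.2) :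
    laurent S C x ∈ residueClass (laurent S c r) :=
  sum_mem_residueClass S fun m hm => mul_mem_residueClass
    (mul_mem_residueClass (hC m hm) (zpow_mem_residueClass h1 hx1 _))
    (zpow_mem_residueClass h2 hx2 _)

/-- The difference quotients of `φ` on the residue class of `r` have residue `d`. -/
def HasQuotient (φ : K → K) (r d : 𝓀[K]) : Prop :=
  ∀ x ∈ residueClass r, ∀ y ∈ residueClass r, ∃ t ∈ residueClass d, φ x - φ y = t * (x - y)

/-- This product rule and the one for `x⁻¹` let an induction in both directions reach every integer
exponent. -/
theorem HasQuotient.mul_id {φ : K → K} {r ρ d : 𝓀[K]} (h : HasQuotient φ r d)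
    (hφ : ∀ x ∈ residueClass r, φ x ∈ residueClass ρ) :
    HasQuotient (fun x => φ x * x) r (d * r + ρ) := by
  intro x hx y hy
  obtain ⟨t, ht, he⟩ := h x hx y hy
  refine ⟨t * x + φ y, add_mem_residueClass (mul_mem_residueClass ht hx) (hφ y hy), ?_⟩
  linear_combination x * he

theorem HasQuotient.mul_inv {φ : K → K} {r ρ d : 𝓀[K]} (hr : r ≠ 0) (h : HasQuotient φ r d)
    (hφ : ∀ x ∈ residueClass r, φ x ∈ residueClass ρ) :
    HasQuotient (fun x => φ x * x⁻¹) r (d * r⁻¹ - ρ * (r⁻¹ * r⁻¹)) := by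
  intro x hx y hy
  obtain ⟨t, ht, he⟩ := h x hx y hy
  have hx0 := ne_zero_of_mem_residueClass hr hx
  have hy0 := ne_zero_of_mem_residueClass hr hy
  have hxi := inv_mem_residueClass hr hx
  refine ⟨t * x⁻¹ - φ y * (x⁻¹ * y⁻¹), sub_mem_residueClass (mul_mem_residueClass ht hxi)
    (mul_mem_residueClass (hφ y hy) (mul_mem_residueClass hxi (inv_mem_residueClass hr hy))), ?_⟩
  field_simp
  linear_combination y * he

theorem hasQuotient_zpow {r : 𝓀[K]} (hr : r ≠ 0) (n : ℤ) :
    HasQuotient (fun x => x ^ n) r (n * r ^ (n - 1)) := by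
  induction n with
  | zero =>
    intro x _ y _
    exact ⟨0, by simpa using zero_mem_residueClass, by simp⟩
  | succ n ih =>
    intro x hx y hy
    obtain ⟨t, ht, he⟩ := ih.mul_id (fun z hz => zpow_mem_residueClass hr hz _) x hx y hy
    refine ⟨t, ?_, ?_⟩
    · convert ht using 2
      rw [add_sub_cancel_right, mul_assoc, ← zpow_add_one₀ hr, sub_add_cancel]
      push_cast
      ring
    · simpa [zpow_add_one₀ (ne_zero_of_mem_residueClass hr hx),
        zpow_add_one₀ (ne_zero_of_mem_residueClass hr hy)] using he
  | pred n ih =>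
    intro x hx y hy
    obtain ⟨t, ht, he⟩ := ih.mul_inv hr (fun z hz => zpow_mem_residueClass hr hz _) x hx y hy
    refine ⟨t, ?_, ?_⟩
    · convert ht using 2
      rw [zpow_sub_one₀ hr, zpow_sub_one₀ hr]
      push_cast
      ring
    · beta_reduce
      rw [zpow_sub_one₀ (ne_zero_of_mem_residueClass hr hx),
        zpow_sub_one₀ (ne_zero_of_mem_residueClass hr hy)]
      exact he

theorem HasQuotient.const_mul {φ : K → K} {r d : 𝓀[K]} (h : HasQuotient φ r d) {a : K} {α : 𝓀[K]}
    (ha : a ∈ residueClass α) : HasQuotient (fun x => a * φ x) r (α * d) := by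
  intro x hx y hy
  obtain ⟨t, ht, he⟩ := h x hx y hy
  exact ⟨a * t, mul_mem_residueClass ha ht, by linear_combination a * he⟩

theorem HasQuotient.sum {ι : Type*} (S : Finset ι) {φ : ι → K → K} {r : 𝓀[K]} {d : ι → 𝓀[K]}
    (h : ∀ i ∈ S, HasQuotient (φ i) r (d i)) :
    HasQuotient (fun x => ∑ i ∈ S, φ i x) r (∑ i ∈ S, d i) := by
  intro x hx y hy
  choose! t ht he using fun i hi => h i hi x hx y hy
  refine ⟨∑ i ∈ S, t i, sum_mem_residueClass S ht, ?_⟩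
  rw [← Finset.sum_sub_distrib, Finset.sum_mul]
  exact Finset.sum_congr rfl he

theorem hasQuotient_laurent_fst {S : Finset (ℤ × ℤ)} {C : ℤ × ℤ → K} {c : ℤ × ℤ → 𝓀[K]}
    (hC : ∀ m ∈ S, C m ∈ residueClass (c m)) {r : 𝓀[K] × 𝓀[K]} (h1 : r.1 ≠ 0) (h2 : r.2 ≠ 0)
    {y : K} (hy : y ∈ residueClass r.2) :
    HasQuotient (fun x => laurent S C (x, y)) r.1 (laurentFst S c r) := by
  have := HasQuotient.sum S fun m hm => (hasQuotient_zpow h1 m.1).const_mul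
    (mul_mem_residueClass (hC m hm) (zpow_mem_residueClass h2 hy m.2))
  convert this using 1
  · ext x
    exact Finset.sum_congr rfl fun m _ => by ring
  · exact Finset.sum_congr rfl fun m _ => by ring

theorem hasQuotient_laurent_snd {S : Finset (ℤ × ℤ)} {C : ℤ × ℤ → K} {c : ℤ × ℤ → 𝓀[K]}
    (hC : ∀ m ∈ S, C m ∈ residueClass (c m)) {r : 𝓀[K] × 𝓀[K]} (h1 : r.1 ≠ 0) (h2 : r.2 ≠ 0)
    {x : K} (hx : x ∈ residueClass r.1) :
    HasQuotient (fun y => laurent S C (x, y)) r.2 (laurentSnd S c r) :=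
  HasQuotient.sum S fun m hm => (hasQuotient_zpow h2 m.2).const_mul
    (mul_mem_residueClass (hC m hm) (zpow_mem_residueClass h1 hx m.1))

/-- Approximate roots to any precision, by Newton iteration. -/
theorem HasQuotient.exists_mem_ball {φ : K → K} {r d : 𝓀[K]} (h : HasQuotient φ r d) (hd : d ≠ 0)
    (hφ : ∀ x ∈ residueClass r, φ x ∈ residueClass 0) (k : ℕ) :
    ∃ y ∈ residueClass r, φ y ∈ ball K (k + 1) := by
  induction k with
  | zero =>
    obtain ⟨x₀, rfl⟩ := IsLocalRing.residue_surjective r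
    have hx : (x₀ : K) ∈ residueClass (IsLocalRing.residue 𝒪[K] x₀) := ⟨x₀.2, rfl⟩
    refine ⟨x₀, hx, ?_⟩
    simpa [residueClass_zero] using hφ _ hx
  | succ k ih =>
    obtain ⟨y, hy, hk⟩ := ih
    obtain ⟨D, rfl⟩ := IsLocalRing.residue_surjective d
    have hD : (D : K) ∈ residueClass (IsLocalRing.residue 𝒪[K] D) := ⟨D.2, rfl⟩
    have hD0 := ne_zero_of_mem_residueClass hd hD
    have hDi := inv_mem_residueClass hd hD
    have hy' : y - φ y * (D : K)⁻¹ ∈ residueClass r := by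
      simpa using sub_mem_residueClass hy (mul_mem_residueClass (hφ y hy) hDi)
    refine ⟨_, hy', ?_⟩
    obtain ⟨t, ht, he⟩ := h _ hy' y hy
    -- The slope is frozen at a lift `D` of `d`. Since `t` also reduces to `d`, the factor `1 - t
    -- D⁻¹` reduces to zero, and each iteration gains one order.
    have h0 : 1 - t * (D : K)⁻¹ ∈ residueClass (0 : 𝓀[K]) := by
      simpa [hd] using sub_mem_residueClass one_mem_residueClass (mul_mem_residueClass ht hDi)
    have h1 : φ (y - φ y * (D : K)⁻¹) = φ y * (1 - t * (D : K)⁻¹) := by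
      linear_combination he
    rw [residueClass_zero] at h0
    rw [h1, mem_ball, map_mul]
    refine (mul_le_mul' hk h0).trans ?_
    rw [← WithZero.exp_add, WithZero.exp_le_exp]
    push_cast
    linarith

/-- The difference quotients are units, so `φ` preserves distances on the residue class. An
approximate root `y` therefore serves as the centre, and no exact root is needed. -/
theorem HasQuotient.setOf_mem_ball_eq {φ : K → K} {r d : 𝓀[K]} (h : HasQuotient φ r d)
    (hd : d ≠ 0) {y : K} (hy : y ∈ residueClass r) (k : ℕ) (hk : φ y ∈ ball K (k + 1)) :
    {x | x ∈ residueClass r ∧ φ x ∈ ball K (k + 1)} = (fun x => -y + x) ⁻¹' ball K (k + 1) := by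
  have hval : ∀ x ∈ residueClass r, val K (φ x - φ y) = val K (x - y) := by
    intro x hx
    obtain ⟨t, ht, he⟩ := h x hx y hy
    rw [he, map_mul, val_eq_one_iff_residueClass.2 ⟨d, hd, ht⟩, one_mul]
  ext x
  simp only [Set.mem_ofPred_eq, Set.mem_preimage, neg_add_eq_sub]
  constructor
  · rintro ⟨hx, hxk⟩
    rw [mem_ball, ← hval x hx]
    exact (val K).map_sub_le hxk hk
  · intro hx
    have hx1 : x - y ∈ residueClass (0 : 𝓀[K]) := by
      rw [residueClass_zero]
      exact ball_antitone (by linarith) hx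
    have hxr : x ∈ residueClass r := by simpa using add_mem_residueClass hx1 hy
    refine ⟨hxr, ?_⟩
    have := (val K).map_add_le (x := φ x - φ y) (y := φ y) ((hval x hxr).le.trans hx) hk
    rwa [sub_add_cancel] at this

end ResidueClass

/-! ### Measures of level sets in the unit torus -/

section LevelSets

variable {K : Type*} [Field K] [ValuativeRel K] [TopologicalSpace K]
  [IsNonarchimedeanLocalField K] [MeasurableSpace K] [BorelSpace K]
  {μ : Measure K} [μ.IsAddHaarMeasure]

theorem HasQuotient.measure_level {φ : K → K} {r d : 𝓀[K]} (h : HasQuotient φ r d)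
    (hd : d ≠ 0) (hφ : ∀ x ∈ residueClass r, φ x ∈ residueClass 0)
    (hμ : μ (𝒪[K] : Set K) = 1) (k : ℕ) :
    μ {x | x ∈ residueClass r ∧ φ x ∈ ball K (k + 1)} =
      ENNReal.ofReal ((q K : ℝ) ^ (-(k + 1) : ℤ)) := by
  obtain ⟨y, hy, hk⟩ := h.exists_mem_ball hd hφ k
  rw [h.setOf_mem_ball_eq hd hy k hk, measure_preimage_add, measure_ball hμ]

theorem measurable_laurent (S : Finset (ℤ × ℤ)) (C : ℤ × ℤ → K) : Measurable (laurent S C) := by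
  have hz : ∀ n : ℤ, Measurable fun x : K => x ^ n := by
    intro n
    cases n with
    | ofNat n => simpa using (measurable_id (α := K)).pow_const n
    | negSucc n =>
      simp only [zpow_negSucc]
      exact ((measurable_id (α := K)).pow_const (n + 1)).inv
  unfold laurent
  refine Finset.measurable_sum _ fun m _ => ?_
  exact (((hz m.1).comp measurable_fst).const_mul (C m)).mul ((hz m.2).comp measurable_snd)

/-- The part of a level set inside a product of two residue classes. -/
def levelClass (S : Finset (ℤ × ℤ)) (C : ℤ × ℤ → K) (k : ℤ) (r : 𝓀[K] × 𝓀[K]) : Set (K × K) :=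
  {x | x.1 ∈ residueClass r.1 ∧ x.2 ∈ residueClass r.2 ∧ laurent S C x ∈ ball K k}

theorem measurableSet_levelClass (S : Finset (ℤ × ℤ)) (C : ℤ × ℤ → K) (k : ℤ)
    (r : 𝓀[K] × 𝓀[K]) : MeasurableSet (levelClass S C k r) :=
  (measurable_fst (measurableSet_residueClass r.1)).inter
    ((measurable_snd (measurableSet_residueClass r.2)).inter
      (measurable_laurent S C (measurableSet_ball k)))

theorem lintegral_residueClass_eq {g : K → ENNReal} {r : 𝓀[K]} {a : ENNReal}
    (h1 : ∀ x ∈ residueClass r, g x = a) (h2 : ∀ x ∉ residueClass r, g x = 0)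
    (hμ : μ (𝒪[K] : Set K) = 1) : ∫⁻ x, g x ∂μ = a * ENNReal.ofReal (q K : ℝ)⁻¹ := by
  have : g = (residueClass r).indicator fun _ => a := by
    ext x
    by_cases hx : x ∈ residueClass r
    · simp [hx, h1 x hx]
    · simp [hx, h2 x hx]
  rw [this, lintegral_indicator_const (measurableSet_residueClass r), measure_residueClass_eq_ball,
    measure_ball_one hμ]

/-- Some partial derivative is nonzero at `r`. Slicing along that variable gives balls of measure
`q^(-k-1)`, and the other variable contributes the measure `q^(-1)` of a residue class. -/
theorem measure_levelClass {S : Finset (ℤ × ℤ)} {C : ℤ × ℤ → K} {c : ℤ × ℤ → 𝓀[K]}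
    (hC : ∀ m ∈ S, C m ∈ residueClass (c m)) {r : 𝓀[K] × 𝓀[K]} (h1 : r.1 ≠ 0) (h2 : r.2 ≠ 0)
    (hr : laurent S c r = 0) (hns : ¬ (laurentFst S c r = 0 ∧ laurentSnd S c r = 0))
    (hμ : μ (𝒪[K] : Set K) = 1) (k : ℕ) :
    (μ.prod μ) (levelClass S C (k + 1) r) = ENNReal.ofReal ((q K : ℝ) ^ (-(k + 2) : ℤ)) := by
  have hq : ENNReal.ofReal ((q K : ℝ) ^ (-(k + 2) : ℤ)) =
      ENNReal.ofReal ((q K : ℝ) ^ (-(k + 1) : ℤ)) * ENNReal.ofReal (q K : ℝ)⁻¹ := by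
    rw [← ENNReal.ofReal_mul (by positivity), ← zpow_sub_one₀ q_pos.ne']
    ring_nf
  have h0 : ∀ x : K × K, x.1 ∈ residueClass r.1 → x.2 ∈ residueClass r.2 →
      laurent S C x ∈ residueClass (0 : 𝓀[K]) := by
    intro x hx1 hx2
    simpa [hr] using laurent_mem_residueClass hC h1 h2 hx1 hx2
  by_cases hd : laurentSnd S c r = 0
  · have hd' : laurentFst S c r ≠ 0 := fun h => hns ⟨h, hd⟩
    rw [Measure.prod_apply_symm (measurableSet_levelClass _ _ _ _), hq]
    refine lintegral_residueClass_eq (r := r.2) (fun y hy => ?_) (fun y hy => ?_) hμ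
    · rw [← (hasQuotient_laurent_fst hC h1 h2 hy).measure_level hd' (fun x hx => h0 _ hx hy) hμ k]
      congr 1
      ext x
      simp [levelClass, hy]
    · convert measure_empty (μ := μ)
      ext x
      simp [levelClass, hy]
  · rw [Measure.prod_apply (measurableSet_levelClass _ _ _ _), hq]
    refine lintegral_residueClass_eq (r := r.1) (fun y hy => ?_) (fun y hy => ?_) hμ
    · rw [← (hasQuotient_laurent_snd hC h1 h2 hy).measure_level hd (fun x hx => h0 _ hy hx) hμ k]
      congr 1
      ext x
      simp [levelClass, hy]
    · convert measure_empty (μ := μ)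
      ext x
      simp [levelClass, hy]

/-- The points of the unit torus where `laurent S C` lies in a given ball. -/
def unitLevel (S : Finset (ℤ × ℤ)) (C : ℤ × ℤ → K) (k : ℤ) : Set (K × K) :=
  {x | val K x.1 = 1 ∧ val K x.2 = 1 ∧ laurent S C x ∈ ball K k}

omit [MeasurableSpace K] [BorelSpace K] in
theorem setOf_val_eq_one : {x : K | val K x = 1} = ball K 0 \ ball K 1 := by
  ext x
  simp only [ball, Set.mem_sdiff, Set.mem_ofPred_eq]
  rw [← lt_one_iff_le_exp, not_lt, neg_zero, WithZero.exp_zero]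
  exact ⟨fun h => ⟨h.le, h.ge⟩, fun h => le_antisymm h.1 h.2⟩

theorem measurableSet_val_eq_one : MeasurableSet {x : K | val K x = 1} := by
  rw [setOf_val_eq_one]
  exact (measurableSet_ball 0).diff (measurableSet_ball 1)

theorem measurableSet_unitLevel (S : Finset (ℤ × ℤ)) (C : ℤ × ℤ → K) (k : ℤ) :
    MeasurableSet (unitLevel S C k) :=
  (measurable_fst measurableSet_val_eq_one).inter
    ((measurable_snd measurableSet_val_eq_one).inter
      (measurable_laurent S C (measurableSet_ball k)))

theorem measure_val_eq_one (hμ : μ (𝒪[K] : Set K) = 1) :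
    μ {x : K | val K x = 1} = ENNReal.ofReal (1 - (q K : ℝ)⁻¹) := by
  rw [setOf_val_eq_one, measure_sdiff _ (measurableSet_ball 1).nullMeasurableSet, measure_ball_one hμ, ball_zero,
    hμ, ENNReal.ofReal_sub _ (by positivity), ENNReal.ofReal_one]
  · rw [measure_ball_one hμ]
    exact ENNReal.ofReal_ne_top
  · exact ball_antitone zero_le_one

omit [MeasurableSpace K] [BorelSpace K] in
theorem unitLevel_zero {S : Finset (ℤ × ℤ)} {C : ℤ × ℤ → K} {c : ℤ × ℤ → 𝓀[K]}
    (hC : ∀ m ∈ S, C m ∈ residueClass (c m)) :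
    unitLevel S C 0 = {x : K | val K x = 1} ×ˢ {x : K | val K x = 1} := by
  ext x
  simp only [unitLevel, Set.mem_ofPred_eq, Set.mem_prod]
  refine ⟨fun h => ⟨h.1, h.2.1⟩, fun h => ⟨h.1, h.2, ?_⟩⟩
  obtain ⟨r, hr, hxr⟩ := val_eq_one_iff_residueClass.1 h.1
  obtain ⟨t, ht, hxt⟩ := val_eq_one_iff_residueClass.1 h.2
  obtain ⟨hl, _⟩ := laurent_mem_residueClass (r := (r, t)) hC hr ht hxr hxt
  rw [ball_zero]
  exact hl

theorem measure_unitLevel_zero {S : Finset (ℤ × ℤ)} {C : ℤ × ℤ → K} {c : ℤ × ℤ → 𝓀[K]}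
    (hC : ∀ m ∈ S, C m ∈ residueClass (c m)) (hμ : μ (𝒪[K] : Set K) = 1) :
    (μ.prod μ) (unitLevel S C 0) = ENNReal.ofReal ((1 - (q K : ℝ)⁻¹) ^ 2) := by
  have hq : 0 ≤ 1 - (q K : ℝ)⁻¹ := by
    rw [sub_nonneg]
    exact inv_le_one_of_one_le₀ (by exact_mod_cast one_lt_q.le)
  rw [unitLevel_zero hC, Measure.prod_prod, measure_val_eq_one hμ, pow_two, ENNReal.ofReal_mul hq]

/-- A value of positive order forces the reduced point to be a zero of the reduction, so the set
splits over these zeros, each contributing the same measure. -/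
theorem measure_unitLevel_succ {S : Finset (ℤ × ℤ)} {C : ℤ × ℤ → K} {c : ℤ × ℤ → 𝓀[K]}
    (hC : ∀ m ∈ S, C m ∈ residueClass (c m))
    (hns : ∀ r : 𝓀[K] × 𝓀[K], r.1 ≠ 0 → r.2 ≠ 0 →
      ¬ (laurent S c r = 0 ∧ laurentFst S c r = 0 ∧ laurentSnd S c r = 0))
    (hμ : μ (𝒪[K] : Set K) = 1) (k : ℕ) :
    (μ.prod μ) (unitLevel S C (k + 1)) = ENNReal.ofReal
      (Nat.card {r : 𝓀[K] × 𝓀[K] // r.1 ≠ 0 ∧ r.2 ≠ 0 ∧ laurent S c r = 0} *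
        (q K : ℝ) ^ (-(k + 2) : ℤ)) := by
  have hU : unitLevel S C (k + 1) =
      ⋃ r : {r : 𝓀[K] × 𝓀[K] // r.1 ≠ 0 ∧ r.2 ≠ 0 ∧ laurent S c r = 0},
        levelClass S C (k + 1) r.1 := by
    ext x
    simp only [unitLevel, Set.mem_ofPred_eq, Set.mem_iUnion, levelClass]
    constructor
    · rintro ⟨h1, h2, h3⟩
      obtain ⟨r, hr, hxr⟩ := val_eq_one_iff_residueClass.1 h1
      obtain ⟨t, ht, hxt⟩ := val_eq_one_iff_residueClass.1 h2
      have hl := laurent_mem_residueClass (r := (r, t)) hC hr ht hxr hxt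
      refine ⟨⟨(r, t), hr, ht, ?_⟩, hxr, hxt, h3⟩
      refine eq_of_mem_residueClass hl ?_
      rw [residueClass_zero]
      exact ball_antitone (by linarith) h3
    · rintro ⟨⟨r, hr1, hr2, _⟩, h1, h2, h3⟩
      exact ⟨val_eq_one_iff_residueClass.2 ⟨_, hr1, h1⟩, val_eq_one_iff_residueClass.2 ⟨_, hr2, h2⟩,
        h3⟩
  have := Fintype.ofFinite {r : 𝓀[K] × 𝓀[K] // r.1 ≠ 0 ∧ r.2 ≠ 0 ∧ laurent S c r = 0}
  have hm : ∀ r : {r : 𝓀[K] × 𝓀[K] // r.1 ≠ 0 ∧ r.2 ≠ 0 ∧ laurent S c r = 0},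
      (μ.prod μ) (levelClass S C (k + 1) r.1) = ENNReal.ofReal ((q K : ℝ) ^ (-(k + 2) : ℤ)) := by
    rintro ⟨r, h1, h2, h3⟩
    exact measure_levelClass hC h1 h2 h3 (fun h => hns r h1 h2 ⟨h3, h⟩) hμ k
  rw [hU, measure_iUnion _ fun r => measurableSet_levelClass _ _ _ _, tsum_fintype]
  · simp only [hm]
    rw [Finset.sum_const, Finset.card_univ, nsmul_eq_mul, ENNReal.ofReal_mul (by positivity),
      ENNReal.ofReal_natCast, Nat.card_eq_fintype_card]
  · intro r t hrt
    rw [Function.onFun, Set.disjoint_left]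
    intro x hx hx'
    exact hrt (Subtype.ext (Prod.ext (eq_of_mem_residueClass hx.1 hx'.1)
      (eq_of_mem_residueClass hx.2.1 hx'.2.1)))

end LevelSets

/-! ### Faces of lattice polygons and linearity of `d` on cones -/

section PlaneGeometry

theorem toReal_add (a b : ℤ × ℤ) : toReal (a + b) = toReal a + toReal b := by
  simp [toReal]

theorem toReal_sub (a b : ℤ × ℤ) : toReal (a - b) = toReal a - toReal b := by
  simp [toReal]

theorem toReal_zsmul (n : ℤ) (a : ℤ × ℤ) : toReal (n • a) = (n : ℝ) • toReal a := by
  simp [toReal]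

theorem toReal_sum {ι : Type*} (s : Finset ι) (v : ι → ℤ × ℤ) :
    toReal (∑ i ∈ s, v i) = ∑ i ∈ s, toReal (v i) :=
  map_sum (⟨⟨toReal, by simp [toReal]⟩, toReal_add⟩ : ℤ × ℤ →+ ℝ × ℝ) v s

theorem toReal_injective : Function.Injective toReal := by
  intro a b h
  simp only [toReal, Prod.mk.injEq, Int.cast_inj] at h
  exact Prod.ext h.1 h.2

theorem pair_add_left (a b x : ℝ × ℝ) : pair (a + b) x = pair a x + pair b x := by
  simp [pair]
  ring

theorem pair_smul_left (c : ℝ) (a x : ℝ × ℝ) : pair (c • a) x = c * pair a x := by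
  simp [pair]
  ring

theorem isLinearMap_pair (a : ℝ × ℝ) : IsLinearMap ℝ (pair a) where
  map_add x y := by simp [pair]; ring
  map_smul c x := by simp [pair]; ring

/-- A linear function on a lattice polytope attains its minimum at a lattice point. -/
theorem exists_dist_eq_pair (T : Finset (ℤ × ℤ)) (hT : T.Nonempty) (a : ℝ × ℝ) :
    ∃ l ∈ T, dist (convexHull ℝ (toReal '' (T : Set (ℤ × ℤ)))) a = pair a (toReal l) ∧
      ∀ x ∈ convexHull ℝ (toReal '' (T : Set (ℤ × ℤ))), pair a (toReal l) ≤ pair a x := by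
  obtain ⟨l, hl, hmin⟩ := T.exists_min_image (fun l => pair a (toReal l)) hT
  have h : ∀ x ∈ convexHull ℝ (toReal '' (T : Set (ℤ × ℤ))), pair a (toReal l) ≤ pair a x := by
    have : convexHull ℝ (toReal '' (T : Set (ℤ × ℤ))) ⊆ {x | pair a (toReal l) ≤ pair a x} := by
      refine convexHull_min ?_ (convex_halfSpace_ge (isLinearMap_pair a) _)
      rintro _ ⟨m, hm, rfl⟩
      exact hmin m hm
    exact this
  refine ⟨l, hl, ?_, h⟩
  refine IsLeast.csInf_eq ⟨⟨_, subset_convexHull ℝ _ ⟨l, hl, rfl⟩, rfl⟩, ?_⟩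
  rintro _ ⟨x, hx, rfl⟩
  exact h x hx

theorem dist_le_pair (T : Finset (ℤ × ℤ)) (a : ℝ × ℝ) {x : ℝ × ℝ}
    (hx : x ∈ convexHull ℝ (toReal '' (T : Set (ℤ × ℤ)))) :
    dist (convexHull ℝ (toReal '' (T : Set (ℤ × ℤ)))) a ≤ pair a x := by
  have hT : T.Nonempty := by
    by_contra h
    rw [Finset.not_nonempty_iff_eq_empty] at h
    simp [h] at hx
  obtain ⟨l, _, h1, h2⟩ := exists_dist_eq_pair T hT a
  rw [h1]
  exact h2 x hx

/-- This replaces a limit `ε → 0` when passing from an open cone to its closure. -/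
theorem nonneg_of_forall_pos_add_mul {x y : ℝ} (h : ∀ ε > 0, 0 ≤ x + ε * y) : 0 ≤ x := by
  by_contra! hx
  have hy : 0 < |y| + 1 := by positivity
  have h1 := h (-x / (|y| + 1)) (div_pos (neg_pos.2 hx) hy)
  have h2 : -x / (|y| + 1) * y ≤ -x / (|y| + 1) * |y| :=
    mul_le_mul_of_nonneg_left (le_abs_self y) (div_pos (neg_pos.2 hx) hy).le
  have h3 : -x / (|y| + 1) * (|y| + 1) = -x := div_mul_cancel₀ _ hy.ne'
  have h4 : 0 < -x / (|y| + 1) := div_pos (neg_pos.2 hx) hy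
  linarith

theorem smul_sum_mem_openCone {g : Finset (ℤ × ℤ)} {c : ℤ × ℤ → ℝ} (hc : ∀ a ∈ g, 0 ≤ c a)
    {ε : ℝ} (hε : 0 < ε) :
    ∑ a ∈ g, c a • toReal a + ε • ∑ a ∈ g, toReal a ∈ openCone g := by
  refine ⟨fun a => c a + ε, fun a ha => add_pos_of_nonneg_of_pos (hc a ha) hε, ?_⟩
  rw [Finset.smul_sum, ← Finset.sum_add_distrib]
  exact Finset.sum_congr rfl fun a _ => (add_smul _ _ _).symm

/-- The function `dist` is linear on the closure of a cone on which the meet locus is constant. -/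
theorem exists_dist_eq_pair_on_cone (T : Finset (ℤ × ℤ)) (hT : T.Nonempty)
    {τ : Set (ℝ × ℝ)} {g : Finset (ℤ × ℤ)}
    (hg : openCone g ⊆ faceCone (convexHull ℝ (toReal '' (T : Set (ℤ × ℤ)))) τ) :
    ∃ l ∈ T, ∀ c : ℤ × ℤ → ℝ, (∀ a ∈ g, 0 ≤ c a) →
      dist (convexHull ℝ (toReal '' (T : Set (ℤ × ℤ)))) (∑ a ∈ g, c a • toReal a) =
        pair (∑ a ∈ g, c a • toReal a) (toReal l) := by
  -- The sum of the generators lies in the open cone, so a minimiser `l` for it belongs to `τ` and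
  -- hence minimises for every vector of the open cone.
  obtain ⟨l, hl, h1, -⟩ := exists_dist_eq_pair T hT (∑ a ∈ g, (1 : ℝ) • toReal a)
  have hb : ∑ a ∈ g, (1 : ℝ) • toReal a ∈ openCone g := ⟨fun _ => 1, by simp, rfl⟩
  have hlΓ := subset_convexHull ℝ _ (Set.mem_image_of_mem toReal (Finset.mem_coe.2 hl))
  have hlτ : toReal l ∈ τ := by
    rw [← hg hb]
    exact ⟨hlΓ, h1.symm⟩
  refine ⟨l, hl, fun c hc => le_antisymm (dist_le_pair T _ hlΓ) ?_⟩
  obtain ⟨m, hm, h2, -⟩ := exists_dist_eq_pair T hT (∑ a ∈ g, c a • toReal a)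
  have hmΓ := subset_convexHull ℝ _ (Set.mem_image_of_mem toReal (Finset.mem_coe.2 hm))
  rw [h2, ← sub_nonneg]
  refine nonneg_of_forall_pos_add_mul
    (y := pair (∑ a ∈ g, toReal a) (toReal m) - pair (∑ a ∈ g, toReal a) (toReal l))
    fun ε hε => ?_
  -- A boundary vector is pushed into the open cone by `ε` times the sum of the generators. There
  -- `l` is at least as good as the minimiser `m` of the boundary vector.
  have h3 := hg (smul_sum_mem_openCone hc hε)
  have h4 : toReal l ∈ meetLocus (convexHull ℝ (toReal '' (T : Set (ℤ × ℤ))))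
    (∑ a ∈ g, c a • toReal a + ε • ∑ a ∈ g, toReal a) := by rwa [h3]
  have h5 := dist_le_pair T (∑ a ∈ g, c a • toReal a + ε • ∑ a ∈ g, toReal a) hmΓ
  rw [← h4.2, pair_add_left, pair_add_left, pair_smul_left, pair_smul_left] at h5
  linarith

/-- The generators of a cone contained in the punctured quadrant have positive weight. -/
theorem weight_pos {g : Finset (ℤ × ℤ)}
    (hli : LinearIndependent ℝ (fun a : {a // a ∈ g} => toReal a))
    (hg : openCone g ⊆ quadrant \ {0}) {a : ℤ × ℤ} (ha : a ∈ g) : 0 < weight a := by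
  classical
  have hs : ∑ b ∈ g, (if b = a then (1 : ℝ) else 0) • toReal b = toReal a := by
    rw [Finset.sum_eq_single a (fun b _ hb => by simp [hb]) (fun h => absurd ha h)]
    simp
  have h : ∀ ε : ℝ, ε > 0 → toReal a + ε • ∑ b ∈ g, toReal b ∈ quadrant := by
    intro ε hε
    have := smul_sum_mem_openCone (g := g) (c := fun b => if b = a then 1 else 0)
      (fun b _ => by positivity) (ε := ε) hε
    rw [hs] at this
    exact (hg this).1
  have h1 : 0 ≤ (toReal a).1 := nonneg_of_forall_pos_add_mul fun ε hε => (h ε hε).1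
  have h2 : 0 ≤ (toReal a).2 := nonneg_of_forall_pos_add_mul fun ε hε => (h ε hε).2
  have h3 : toReal a ≠ 0 := hli.ne_zero ⟨a, ha⟩
  simp only [toReal, Int.cast_nonneg_iff] at h1 h2
  have h4 : a ≠ 0 := by
    rintro rfl
    simp [toReal] at h3
  rw [weight]
  by_contra! h5
  exact h4 (Prod.ext (by simp; lia) (by simp; lia))

end PlaneGeometry

/-! ### Generating sums of simplicial cones -/

section GeneratingSums

theorem hasSum_mul_of_summable_norm {ι κ : Type*} {f : ι → ℂ} {g : κ → ℂ} {a b : ℂ}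
    (hf : HasSum f a) (hg : HasSum g b) (hf' : Summable fun i => ‖f i‖)
    (hg' : Summable fun i => ‖g i‖) : (Summable fun p : ι × κ => ‖f p.1 * g p.2‖) ∧
      HasSum (fun p : ι × κ => f p.1 * g p.2) (a * b) := by
  have h := hf'.mul_norm hg'
  exact ⟨h, hf.mul hg h.of_norm⟩

/-- A product of geometric series, by induction on the index type: passing to `Option` multiplies by
one further series, and absolute summability justifies the product. -/
theorem summable_and_hasSum_prod_pow {ι : Type*} [Fintype ι] :
    ∀ r : ι → ℂ, (∀ i, ‖r i‖ < 1) →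
      (Summable fun k : ι → ℕ => ‖∏ i, r i ^ k i‖) ∧
        HasSum (fun k : ι → ℕ => ∏ i, r i ^ k i) (∏ i, (1 - r i)⁻¹) := by
  refine Fintype.induction_empty_option (P := fun ι [Fintype ι] => ∀ r : ι → ℂ, (∀ i, ‖r i‖ < 1) →
      (Summable fun k : ι → ℕ => ‖∏ i, r i ^ k i‖) ∧
        HasSum (fun k : ι → ℕ => ∏ i, r i ^ k i) (∏ i, (1 - r i)⁻¹)) ?_ ?_ ?_ ι
  · intro α β _ e ih r hr
    let _ := Fintype.ofEquiv β e.symm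
    obtain ⟨h1, h2⟩ := ih (fun i => r (e i)) (fun i => hr _)
    have he : ∀ k : β → ℕ, ∏ i, r (e i) ^ k (e i) = ∏ i, r i ^ k i := fun k => by
      convert Fintype.prod_equiv e (fun i => r (e i) ^ k (e i)) (fun i => r i ^ k i) fun i => rfl
    have hc : ∏ i, (1 - r (e i))⁻¹ = ∏ i, (1 - r i)⁻¹ := by
      convert Fintype.prod_equiv e (fun i => (1 - r (e i))⁻¹) (fun i => (1 - r i)⁻¹) fun i => rfl
    have he' : ∀ k : β → ℕ, ∏ i, r (e i) ^ (Equiv.arrowCongr e.symm (Equiv.refl ℕ) k) i =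
        ∏ i, r i ^ k i := fun k => by
      rw [← he k]
      simp
    rw [← (Equiv.arrowCongr e.symm (Equiv.refl ℕ)).summable_iff] at h1
    rw [← (Equiv.arrowCongr e.symm (Equiv.refl ℕ)).hasSum_iff] at h2
    simp only [Function.comp_def, he', hc] at h1 h2
    exact ⟨h1, h2⟩
  · intro r _
    exact ⟨(hasSum_unique _).summable, by simp⟩
  · intro α _ ih r hr
    obtain ⟨h1, h2⟩ := ih (fun i => r (some i)) (fun i => hr _)
    have h3 : Summable fun n : ℕ => ‖r none ^ n‖ := by
      simpa using summable_geometric_of_lt_one (norm_nonneg _) (hr none)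
    have h4 := hasSum_geometric_of_norm_lt_one (hr none)
    obtain ⟨h5, h6⟩ := hasSum_mul_of_summable_norm h4 h2 h3 h1
    have he : ∀ k : Option α → ℕ, r none ^ (Equiv.piOptionEquivProd (β := fun _ => ℕ) k).1 *
        ∏ i, r (some i) ^ (Equiv.piOptionEquivProd (β := fun _ => ℕ) k).2 i = ∏ i, r i ^ k i :=
      fun k => (Fintype.prod_option fun i => r i ^ k i).symm
    rw [← (Equiv.piOptionEquivProd (β := fun _ => ℕ)).summable_iff] at h5
    rw [← (Equiv.piOptionEquivProd (β := fun _ => ℕ)).hasSum_iff] at h6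
    simp only [Function.comp_def, he] at h5 h6
    rw [Fintype.prod_option]
    exact ⟨h5, h6⟩

/-- Cones are defined with coefficients on all of `ℤ × ℤ`, while linear independence concerns
families indexed by the generators. This translates between the two. -/
theorem exists_coeff_iff {g : Finset (ℤ × ℤ)} {P : ℝ → Prop} {x : ℝ × ℝ} :
    (∃ c : ℤ × ℤ → ℝ, (∀ a ∈ g, P (c a)) ∧ x = ∑ a ∈ g, c a • toReal a) ↔
      ∃ c : {a // a ∈ g} → ℝ, (∀ i, P (c i)) ∧ x = ∑ i, c i • toReal i := by
  classical
  constructor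
  · rintro ⟨c, hc, rfl⟩
    exact ⟨fun i => c i, fun i => hc i i.2, (Finset.sum_coe_sort g fun a => c a • toReal a).symm⟩
  · rintro ⟨c, hc, rfl⟩
    refine ⟨fun a => if h : a ∈ g then c ⟨a, h⟩ else 0, fun a ha => by simpa [ha] using hc _, ?_⟩
    rw [← Finset.sum_coe_sort g fun a => (if h : a ∈ g then c ⟨a, h⟩ else 0) • toReal a]
    simp

theorem mem_openCone_iff {g : Finset (ℤ × ℤ)} {x : ℝ × ℝ} : x ∈ openCone g ↔
    ∃ c : {a // a ∈ g} → ℝ, (∀ i, 0 < c i) ∧ x = ∑ i, c i • toReal i :=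
  exists_coeff_iff (P := fun t => 0 < t)

theorem mem_latticePoints_iff {g : Finset (ℤ × ℤ)} {h : ℤ × ℤ} : h ∈ latticePoints g ↔
    ∃ c : {a // a ∈ g} → ℝ, (∀ i, 0 ≤ c i ∧ c i < 1) ∧ toReal h = ∑ i, c i • toReal i :=
  exists_coeff_iff (P := fun t => 0 ≤ t ∧ t < 1)

/-- Coefficients in `[0, 1)` confine the points to a box. Finiteness ensures that the `∑ᶠ` in
`coneSum` is a genuine sum and not the default value zero. -/
theorem finite_latticePoints (g : Finset (ℤ × ℤ)) : (latticePoints g).Finite := by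
  refine (Set.finite_Icc (-∑ a ∈ g, |a.1|, -∑ a ∈ g, |a.2|)
    (∑ a ∈ g, |a.1|, ∑ a ∈ g, |a.2|)).subset ?_
  rintro h ⟨c, hc, he⟩
  have key : ∀ (φ : ℤ × ℤ → ℤ) (n : ℤ), (n : ℝ) = ∑ a ∈ g, c a * φ a → |n| ≤ ∑ a ∈ g, |φ a| := by
    intro φ n hn
    have : |(n : ℝ)| ≤ ∑ a ∈ g, |(φ a : ℝ)| := by
      rw [hn]
      refine (Finset.abs_sum_le_sum_abs _ _).trans (Finset.sum_le_sum fun a ha => ?_)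
      rw [abs_mul, abs_of_nonneg (hc a ha).1]
      exact mul_le_of_le_one_left (abs_nonneg _) (hc a ha).2.le
    exact_mod_cast this
  have h1 := key Prod.fst h.1 (by simpa [toReal, Prod.fst_sum] using congrArg Prod.fst he)
  have h2 := key Prod.snd h.2 (by simpa [toReal, Prod.snd_sum] using congrArg Prod.snd he)
  rw [abs_le] at h1 h2
  exact ⟨⟨h1.1, h2.1⟩, ⟨h1.2, h2.2⟩⟩

variable {g : Finset (ℤ × ℤ)}

theorem toReal_sum_sub {h : ℤ × ℤ} {c : {a // a ∈ g} → ℝ} (hc : toReal h = ∑ i, c i • toReal i)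
    (k : {a // a ∈ g} → ℤ) :
    toReal (∑ i, k i • (i : ℤ × ℤ) - h) = ∑ i, ((k i : ℝ) - c i) • toReal i := by
  rw [toReal_sub, toReal_sum, hc, ← Finset.sum_sub_distrib]
  exact Finset.sum_congr rfl fun i _ => by rw [toReal_zsmul, sub_smul]

/-- Lattice points of an open simplicial cone, parametrized by the lattice points of the
fundamental parallelogram. -/
def conePoint (p : latticePoints g × ({a // a ∈ g} → ℕ)) :
    {a : ℤ × ℤ // toReal a ∈ openCone g} :=
  ⟨∑ i, ((p.2 i + 1 : ℕ) : ℤ) • (i : ℤ × ℤ) - p.1, by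
    obtain ⟨c, hc, he⟩ := mem_latticePoints_iff.1 p.1.2
    refine mem_openCone_iff.2 ⟨_, fun i => ?_, toReal_sum_sub he _⟩
    have := (hc i).2
    push_cast
    have h0 : (0 : ℝ) ≤ p.2 i := Nat.cast_nonneg _
    linarith⟩

/-- A point with cone coefficients `cᵢ > 0` must have `kᵢ + 1 = ⌈cᵢ⌉`, because `h` has coefficients
in `[0, 1)`. Rounding up and subtracting `h` is what puts `h` with a positive sign in the exponent
of `coneSum`. -/
theorem bijective_conePoint (hli : LinearIndependent ℝ (fun a : {a // a ∈ g} => toReal a)) :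
    Function.Bijective (conePoint (g := g)) := by
  constructor
  · rintro ⟨⟨h, hh⟩, k⟩ ⟨⟨h', hh'⟩, k'⟩ he
    have he := congrArg Subtype.val he
    simp only [conePoint] at he
    obtain ⟨c, hc, hce⟩ := mem_latticePoints_iff.1 hh
    obtain ⟨c', hc', hce'⟩ := mem_latticePoints_iff.1 hh'
    have h1 := congrArg toReal he
    rw [toReal_sum_sub hce, toReal_sum_sub hce', ← sub_eq_zero, ← Finset.sum_sub_distrib] at h1
    simp only [← sub_smul] at h1
    have h2 := Fintype.linearIndependent_iff.1 hli _ h1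
    have hk : k = k' := by
      ext i
      have h3 := h2 i
      push_cast at h3
      have h4 : (k i : ℝ) < k' i + 1 := by linarith [(hc i).2, (hc i).1, (hc' i).1, (hc' i).2]
      have h5 : (k' i : ℝ) < k i + 1 := by linarith [(hc i).2, (hc i).1, (hc' i).1, (hc' i).2]
      norm_cast at h4 h5
      lia
    subst hk
    simpa using he
  · rintro ⟨a, ha⟩
    obtain ⟨c, hc, he⟩ := mem_openCone_iff.1 ha
    have h2 := toReal_sum_sub (h := a) (g := g) he fun i => ⌈c i⌉
    refine ⟨(⟨∑ i : {a // a ∈ g}, ⌈c i⌉ • (i : ℤ × ℤ) - a, mem_latticePoints_iff.2 ⟨_, fun i => ?_, h2⟩⟩,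
      fun i => (⌈c i⌉ - 1).toNat), Subtype.ext ?_⟩
    · exact ⟨sub_nonneg.2 (Int.le_ceil _), by linarith [Int.ceil_lt_add_one (c i)]⟩
    · simp only [conePoint]
      -- Positivity of `c i` gives `⌈c i⌉ ≥ 1`, so `toNat` truncates nothing.
      have h3 : ∀ i, (((⌈c i⌉ - 1).toNat + 1 : ℕ) : ℤ) = ⌈c i⌉ := fun i => by
        have := Int.ceil_pos.2 (hc i)
        lia
      simp only [h3]
      abel

/-- The generating sum of the lattice points of an open simplicial cone. -/
theorem hasSum_conePoints (hli : LinearIndependent ℝ (fun a : {a // a ∈ g} => toReal a))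
    (E : ℤ × ℤ →+ ℂ) {Q : ℕ} (hQ : 1 < Q) (hE : ∀ a ∈ g, 0 < (E a).re) :
    (Summable fun a : {a : ℤ × ℤ // toReal a ∈ openCone g} => ‖(Q : ℂ) ^ (-E a)‖) ∧
      HasSum (fun a : {a : ℤ × ℤ // toReal a ∈ openCone g} => (Q : ℂ) ^ (-E a))
        (((∑ᶠ h ∈ latticePoints g, (Q : ℂ) ^ E h) * (Q : ℂ) ^ (-∑ a ∈ g, E a)) /
          ∏ a ∈ g, (1 - (Q : ℂ) ^ (-E a))) := by
  have hQ0 : (Q : ℂ) ≠ 0 := by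
    norm_cast
    lia
  have hr : ∀ i : {a // a ∈ g}, ‖(Q : ℂ) ^ (-E i)‖ < 1 := by
    intro i
    rw [Complex.norm_natCast_cpow_of_pos (by lia), Complex.neg_re]
    exact Real.rpow_lt_one_of_one_lt_of_neg (by exact_mod_cast hQ) (neg_neg_of_pos (hE i i.2))
  obtain ⟨h1, h2⟩ := summable_and_hasSum_prod_pow _ hr
  have := (finite_latticePoints g).fintype
  have h3 : HasSum (fun h : latticePoints g => (Q : ℂ) ^ E h * (Q : ℂ) ^ (-∑ a ∈ g, E a))
      ((∑ᶠ h ∈ latticePoints g, (Q : ℂ) ^ E h) * (Q : ℂ) ^ (-∑ a ∈ g, E a)) := by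
    rw [← finsum_set_coe_eq_finsum_mem, finsum_eq_sum_of_fintype, Finset.sum_mul]
    exact hasSum_fintype _
  have h4 : Summable fun h : latticePoints g => ‖(Q : ℂ) ^ E h * (Q : ℂ) ^ (-∑ a ∈ g, E a)‖ :=
    (hasSum_fintype _).summable
  obtain ⟨h5, h6⟩ := hasSum_mul_of_summable_norm h3 h2 h4 h1
  -- Additivity of `E` factors the term at `∑ (kᵢ + 1) aᵢ - h` into a part depending on `h`, a
  -- constant, and powers of the ratios.
  have hterm : ∀ p : latticePoints g × ({a // a ∈ g} → ℕ), (Q : ℂ) ^ (-E (conePoint p)) =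
      (Q : ℂ) ^ E p.1 * (Q : ℂ) ^ (-∑ a ∈ g, E a) *
        ∏ i : {a // a ∈ g}, ((Q : ℂ) ^ (-E (i : ℤ × ℤ))) ^ p.2 i := by
    intro p
    have : -E (conePoint p) = E p.1 + -∑ a ∈ g, E a +
        ∑ i : {a // a ∈ g}, (p.2 i : ℂ) * -E (i : ℤ × ℤ) := by
      simp only [conePoint, map_sub, map_sum, map_zsmul]
      simp only [zsmul_eq_mul]
      rw [← Finset.sum_coe_sort g, ← Finset.sum_neg_distrib, add_assoc, ← Finset.sum_add_distrib,
        neg_sub, sub_eq_add_neg, ← Finset.sum_neg_distrib]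
      congr 1
      refine Finset.sum_congr rfl fun i _ => ?_
      push_cast
      ring
    rw [this, Complex.cpow_add _ _ hQ0, Complex.cpow_add _ _ hQ0]
    congr 1
    induction (Finset.univ : Finset {a // a ∈ g}) using Finset.cons_induction with
    | empty => simp
    | cons i s hi ih =>
      rw [Finset.sum_cons, Finset.prod_cons, Complex.cpow_add _ _ hQ0, ih, Complex.cpow_nat_mul]
  rw [← (Equiv.ofBijective _ (bijective_conePoint hli)).summable_iff,
    ← (Equiv.ofBijective _ (bijective_conePoint hli)).hasSum_iff]
  simp only [Function.comp_def, Equiv.ofBijective_apply, hterm]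
  refine ⟨h5, ?_⟩
  rw [div_eq_mul_inv, ← Finset.prod_inv_distrib,
    ← Finset.prod_coe_sort g fun a => (1 - (Q : ℂ) ^ (-E a))⁻¹]
  exact h6

end GeneratingSums

/-! ### Evaluation of Laurent polynomials and their derivatives -/

section Evaluation

variable {F : Type*} [Field F]

theorem eval_eq_laurent (g : F[ℤ × ℤ]) {S : Finset (ℤ × ℤ)} (hS : g.coeff.support ⊆ S)
    (x : F × F) : eval g x = laurent S g.coeff x :=
  Finsupp.sum_of_support_subset _ hS _ (by simp)

theorem eval_add (g h : F[ℤ × ℤ]) (x : F × F) : eval (g + h) x = eval g x + eval h x :=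
  Finsupp.sum_add_index' (by simp) (by intros; ring)

theorem eval_single (m : ℤ × ℤ) (c : F) (x : F × F) :
    eval (AddMonoidAlgebra.single m c) x = c * x.1 ^ m.1 * x.2 ^ m.2 :=
  Finsupp.sum_single_index (by simp)

theorem eval_sum {ι : Type*} (S : Finset ι) (g : ι → F[ℤ × ℤ]) (x : F × F) :
    eval (∑ i ∈ S, g i) x = ∑ i ∈ S, eval (g i) x :=
  map_sum (⟨⟨fun g => eval g x, by simp [eval]⟩, fun g h => eval_add g h x⟩ : F[ℤ × ℤ] →+ F) g S

theorem eval_pderivFst (g : F[ℤ × ℤ]) {S : Finset (ℤ × ℤ)} (hS : g.coeff.support ⊆ S)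
    (x : F × F) : eval (pderivFst g) x = laurentFst S g.coeff x := by
  rw [pderivFst, Finsupp.sum_of_support_subset _ hS _ (by simp), eval_sum]
  refine Finset.sum_congr rfl fun m _ => ?_
  rw [eval_single]
  simp only [Prod.fst_sub, Prod.snd_sub, sub_zero]
  ring

theorem eval_pderivSnd (g : F[ℤ × ℤ]) {S : Finset (ℤ × ℤ)} (hS : g.coeff.support ⊆ S)
    (x : F × F) : eval (pderivSnd g) x = laurentSnd S g.coeff x := by
  rw [pderivSnd, Finsupp.sum_of_support_subset _ hS _ (by simp), eval_sum]
  refine Finset.sum_congr rfl fun m _ => ?_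
  rw [eval_single]
  simp only [Prod.fst_sub, Prod.snd_sub, sub_zero]
  ring

end Evaluation

/-! ### Rescaling `f` by powers of a uniformizer -/

section Scaling

variable {K : Type*} [Field K] [ValuativeRel K] [TopologicalSpace K]
  [IsNonarchimedeanLocalField K] (f : 𝒪[K][ℤ × ℤ])

theorem support_redFace (τ : Set (ℝ × ℝ)) : (redFace f τ).coeff.support ⊆ f.coeff.support := by
  intro m hm
  rw [Finsupp.mem_support_iff, redFace, AddMonoidAlgebra.coeff_mapRingHom] at hm
  rw [Finsupp.mem_support_iff]
  intro h
  simp [faceFun, Finsupp.filter_apply, h] at hm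

open Classical in
theorem coeff_redFace (τ : Set (ℝ × ℝ)) (m : ℤ × ℤ) : (redFace f τ).coeff m =
    if toReal m ∈ τ then IsLocalRing.residue 𝒪[K] (f.coeff m) else 0 := by
  rw [redFace, AddMonoidAlgebra.coeff_mapRingHom]
  simp only [faceFun, AddMonoidAlgebra.coeff_ofCoeff, Finsupp.filter_apply]
  split_ifs <;> simp

theorem nonDegenerate_laurent (hf : NonDegenerate f) {τ : Set (ℝ × ℝ)}
    (hτ : τ = newton f ∨ IsProperFace (newton f) τ) (r : 𝓀[K] × 𝓀[K]) (h1 : r.1 ≠ 0)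
    (h2 : r.2 ≠ 0) : ¬ (laurent f.coeff.support (redFace f τ).coeff r = 0 ∧
      laurentFst f.coeff.support (redFace f τ).coeff r = 0 ∧
      laurentSnd f.coeff.support (redFace f τ).coeff r = 0) := by
  rw [← eval_eq_laurent _ (support_redFace f τ), ← eval_pderivFst _ (support_redFace f τ),
    ← eval_pderivSnd _ (support_redFace f τ)]
  exact hf τ hτ r h1 h2

theorem N_eq_natCard (τ : Set (ℝ × ℝ)) : N f τ = Nat.card {r : 𝓀[K] × 𝓀[K] // r.1 ≠ 0 ∧ r.2 ≠ 0 ∧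
    laurent f.coeff.support (redFace f τ).coeff r = 0} := by
  simp only [N, eval_eq_laurent _ (support_redFace f τ)]

/-- The polynomial function of `f` on `K × K`. -/
def polyFun (x : K × K) : K := laurent f.coeff.support (fun m => (f.coeff m : K)) x

omit [TopologicalSpace K] [IsNonarchimedeanLocalField K] in
theorem eval_map_subtype (x : K × K) :
    eval (AddMonoidAlgebra.mapRingHom (ℤ × ℤ) 𝒪[K].subtype f) x = polyFun f x := by
  rw [eval_eq_laurent _ (S := f.coeff.support)]
  · simp only [polyFun, laurent, AddMonoidAlgebra.coeff_mapRingHom]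
    rfl
  · intro m hm
    rw [Finsupp.mem_support_iff, AddMonoidAlgebra.coeff_mapRingHom] at hm
    rw [Finsupp.mem_support_iff]
    intro h
    simp [h] at hm

/-- The integer value of `dist` at an integral vector. -/
def intDist (a : ℤ × ℤ) : ℤ := ⌊dist (newton f) (toReal a)⌋

variable {f}

theorem pair_toReal (a m : ℤ × ℤ) :
    pair (toReal a) (toReal m) = ((a.1 * m.1 + a.2 * m.2 : ℤ) : ℝ) := by
  simp [pair, toReal]

omit [TopologicalSpace K] [IsNonarchimedeanLocalField K] in
-- The minimum is attained at a lattice point, so `d(a)` is an integer and the floor is exact.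
theorem intDist_cast (h0 : f.coeff.support.Nonempty) (a : ℤ × ℤ) :
    (intDist f a : ℝ) = dist (newton f) (toReal a) := by
  obtain ⟨l, _, h, -⟩ := exists_dist_eq_pair f.coeff.support h0 (toReal a)
  rw [intDist, newton, h, pair_toReal, Int.floor_intCast]

omit [TopologicalSpace K] [IsNonarchimedeanLocalField K] in
theorem toReal_mem_newton {m : ℤ × ℤ} (hm : m ∈ f.coeff.support) : toReal m ∈ newton f :=
  subset_convexHull ℝ _ ⟨m, hm, rfl⟩

omit [TopologicalSpace K] [IsNonarchimedeanLocalField K] in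
theorem intDist_le (h0 : f.coeff.support.Nonempty) (a : ℤ × ℤ) {m : ℤ × ℤ}
    (hm : m ∈ f.coeff.support) : intDist f a ≤ a.1 * m.1 + a.2 * m.2 := by
  have := dist_le_pair f.coeff.support (toReal a) (toReal_mem_newton hm)
  rw [pair_toReal] at this
  have h := intDist_cast h0 a
  rw [newton] at h
  rw [← h] at this
  exact_mod_cast this

omit [TopologicalSpace K] [IsNonarchimedeanLocalField K] in
theorem toReal_mem_meetLocus_iff (h0 : f.coeff.support.Nonempty) (a : ℤ × ℤ) {m : ℤ × ℤ}
    (hm : m ∈ f.coeff.support) :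
    toReal m ∈ meetLocus (newton f) (toReal a) ↔ a.1 * m.1 + a.2 * m.2 = intDist f a := by
  rw [meetLocus, Set.mem_ofPred_eq, ← intDist_cast h0, pair_toReal, Int.cast_inj]
  exact and_iff_right (toReal_mem_newton hm)

variable (f) in
/-- The coefficients of `p ^ (-d(a)) f(p ^ a u)` as a Laurent polynomial in `u`. -/
def scaledCoeff (p : K) (a m : ℤ × ℤ) : K :=
  f.coeff m * p ^ (a.1 * m.1 + a.2 * m.2 - intDist f a)

/-- Exponents on the face `F(a)` acquire no power of `p`; all others acquire a positive one and
vanish in the residue field. -/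
theorem scaledCoeff_mem_residueClass (h0 : f.coeff.support.Nonempty) {p : K}
    (hp : val K p = WithZero.exp (-1)) (a : ℤ × ℤ) :
    ∀ m ∈ f.coeff.support, scaledCoeff f p a m ∈
      residueClass ((redFace f (meetLocus (newton f) (toReal a))).coeff m) := by
  intro m hm
  rw [coeff_redFace, scaledCoeff]
  have hr : (f.coeff m : K) ∈ residueClass (IsLocalRing.residue 𝒪[K] (f.coeff m)) :=
    ⟨(f.coeff m).2, rfl⟩
  split_ifs with h
  · rw [toReal_mem_meetLocus_iff h0 a hm] at h
    rwa [h, sub_self, zpow_zero, mul_one]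
  · rw [toReal_mem_meetLocus_iff h0 a hm] at h
    have h1 := intDist_le h0 a hm
    have h2 : p ^ (a.1 * m.1 + a.2 * m.2 - intDist f a) ∈ residueClass (0 : 𝓀[K]) := by
      rw [residueClass_zero, mem_ball, map_zpow₀, hp, ← WithZero.exp_zsmul, WithZero.exp_le_exp,
        smul_eq_mul]
      lia
    simpa using mul_mem_residueClass hr h2

omit [TopologicalSpace K] [IsNonarchimedeanLocalField K] in
theorem polyFun_scale {p : K} (hp : p ≠ 0) (a : ℤ × ℤ) (u : K × K) :
    polyFun f (p ^ a.1 * u.1, p ^ a.2 * u.2) =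
      p ^ intDist f a * laurent f.coeff.support (scaledCoeff f p a) u := by
  rw [polyFun, laurent, laurent, Finset.mul_sum]
  refine Finset.sum_congr rfl fun m _ => ?_
  simp only [scaledCoeff, mul_zpow, ← zpow_mul]
  rw [zpow_sub₀ hp, zpow_add₀ hp]
  field_simp

end Scaling

/-! ### Level sets of `f` at a fixed order vector -/

section Pieces

variable {K : Type*} [Field K] [ValuativeRel K] [TopologicalSpace K]
  [IsNonarchimedeanLocalField K] (f : 𝒪[K][ℤ × ℤ])

/-- The points of order `a` at which `f` has order at least `d(a) + k`. -/
def levelSet (a : ℤ × ℤ) (k : ℤ) : Set (K × K) :=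
  {x | val K x.1 = WithZero.exp (-a.1) ∧ val K x.2 = WithZero.exp (-a.2) ∧
    val K (polyFun f x) ≤ WithZero.exp (-(intDist f a + k))}

variable {f}

theorem levelSet_eq_preimage {p : K} (hp : val K p = WithZero.exp (-1)) (a : ℤ × ℤ) (k : ℤ) :
    levelSet f a k = (fun x : K × K => ((p ^ a.1)⁻¹ * x.1, (p ^ a.2)⁻¹ * x.2)) ⁻¹'
      unitLevel f.coeff.support (scaledCoeff f p a) k := by
  have hp0 := ne_zero_of_val_eq_exp hp
  have hpn : ∀ n : ℤ, val K (p ^ n) = WithZero.exp (-n) := by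
    intro n
    rw [map_zpow₀, hp, ← WithZero.exp_zsmul, smul_eq_mul, mul_neg_one]
  ext x
  have hx := polyFun_scale (f := f) hp0 a ((p ^ a.1)⁻¹ * x.1, (p ^ a.2)⁻¹ * x.2)
  simp only [mul_inv_cancel_left₀ (zpow_ne_zero _ hp0)] at hx
  simp only [levelSet, unitLevel, Set.mem_preimage, Set.mem_ofPred_eq, mem_ball]
  rw [hx, map_mul, map_mul, map_mul, map_inv₀, map_inv₀, hpn, hpn, hpn, neg_add, WithZero.exp_add,
    mul_le_mul_iff_right₀ WithZero.exp_pos, inv_mul_eq_one₀ WithZero.exp_ne_zero,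
    inv_mul_eq_one₀ WithZero.exp_ne_zero]
  simp only [eq_comm]

theorem mem_levelSet_zero (h0 : f.coeff.support.Nonempty) {a : ℤ × ℤ} {x : K × K}
    (h1 : val K x.1 = WithZero.exp (-a.1)) (h2 : val K x.2 = WithZero.exp (-a.2)) :
    x ∈ levelSet f a 0 := by
  obtain ⟨p, hp⟩ := exists_uniformizer K
  rw [levelSet_eq_preimage hp, unitLevel_zero (scaledCoeff_mem_residueClass h0 hp a)]
  have hpn : ∀ n : ℤ, val K (p ^ n) = WithZero.exp (-n) := by
    intro n
    rw [map_zpow₀, hp, ← WithZero.exp_zsmul, smul_eq_mul, mul_neg_one]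
  constructor
  · simp only [Set.mem_ofPred_eq, map_mul, map_inv₀, hpn, h1]
    exact inv_mul_cancel₀ WithZero.exp_ne_zero
  · simp only [Set.mem_ofPred_eq, map_mul, map_inv₀, hpn, h2]
    exact inv_mul_cancel₀ WithZero.exp_ne_zero

theorem levelSet_antitone (a : ℤ × ℤ) {j k : ℤ} (h : j ≤ k) : levelSet f a k ⊆ levelSet f a j := by
  intro x hx
  refine ⟨hx.1, hx.2.1, hx.2.2.trans ?_⟩
  rw [WithZero.exp_le_exp]
  lia

omit [TopologicalSpace K] [IsNonarchimedeanLocalField K] in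
-- The zero vector yields the whole polytope, any other vector a supporting line. Thus
-- non-degeneracy applies at every order vector.
theorem meetLocus_eq_newton_or_isProperFace (h0 : f.coeff.support.Nonempty) (a : ℝ × ℝ) :
    meetLocus (newton f) a = newton f ∨ IsProperFace (newton f) (meetLocus (newton f) a) := by
  obtain ⟨l, hl, h1, h2⟩ := exists_dist_eq_pair f.coeff.support h0 a
  by_cases ha : a = 0
  · left
    subst ha
    have h3 : dist (newton f) 0 = 0 := by
      rw [newton, h1]
      simp [pair]
    ext x
    simp [meetLocus, h3, pair]
  · right
    exact ⟨a, dist (newton f) a, ⟨ha, ⟨_, toReal_mem_newton hl, h1.symm⟩,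
      Or.inl fun x hx => dist_le_pair f.coeff.support a hx⟩, rfl⟩

variable [MeasurableSpace K] [BorelSpace K] {μ : Measure K} [μ.IsAddHaarMeasure]

theorem measurableSet_levelSet (a : ℤ × ℤ) (k : ℤ) : MeasurableSet (levelSet f a k) := by
  obtain ⟨p, hp⟩ := exists_uniformizer K
  rw [levelSet_eq_preimage hp]
  exact (by fun_prop : Measurable fun x : K × K => ((p ^ a.1)⁻¹ * x.1, (p ^ a.2)⁻¹ * x.2))
    (measurableSet_unitLevel _ _ _)

theorem measure_levelSet {p : K} (hp : val K p = WithZero.exp (-1)) (hμ : μ (𝒪[K] : Set K) = 1)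
    (a : ℤ × ℤ) (k : ℤ) : (μ.prod μ) (levelSet f a k) =
      ENNReal.ofReal ((q K : ℝ) ^ (-weight a)) *
        (μ.prod μ) (unitLevel f.coeff.support (scaledCoeff f p a) k) := by
  have hpn : ∀ n : ℤ, val K (p ^ n) = WithZero.exp (-n) := by
    intro n
    rw [map_zpow₀, hp, ← WithZero.exp_zsmul, smul_eq_mul, mul_neg_one]
  rw [levelSet_eq_preimage hp, prod_measure_preimage_scale (hpn _) (hpn _) hμ
    (measurableSet_unitLevel _ _ _), weight]

theorem measure_levelSet_zero (h0 : f.coeff.support.Nonempty) (hμ : μ (𝒪[K] : Set K) = 1)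
    (a : ℤ × ℤ) : (μ.prod μ) (levelSet f a 0) =
      ENNReal.ofReal ((q K : ℝ) ^ (-weight a) * (1 - (q K : ℝ)⁻¹) ^ 2) := by
  obtain ⟨p, hp⟩ := exists_uniformizer K
  rw [measure_levelSet hp hμ, measure_unitLevel_zero (scaledCoeff_mem_residueClass h0 hp a) hμ,
    ← ENNReal.ofReal_mul (by positivity)]

theorem measure_levelSet_succ (h0 : f.coeff.support.Nonempty) (hf : NonDegenerate f)
    (hμ : μ (𝒪[K] : Set K) = 1) (a : ℤ × ℤ) (k : ℕ) : (μ.prod μ) (levelSet f a (k + 1)) =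
      ENNReal.ofReal ((q K : ℝ) ^ (-weight a) *
        (N f (meetLocus (newton f) (toReal a)) * (q K : ℝ) ^ (-(k + 2) : ℤ))) := by
  obtain ⟨p, hp⟩ := exists_uniformizer K
  rw [measure_levelSet hp hμ, measure_unitLevel_succ (scaledCoeff_mem_residueClass h0 hp a)
    (nonDegenerate_laurent f hf (meetLocus_eq_newton_or_isProperFace h0 _)) hμ, ← N_eq_natCard,
    ← ENNReal.ofReal_mul (by positivity)]

end Pieces

/-! ### The series over the order of `f` -/

section ShellSeries

/-- The measure of the points `u` of the unit torus with `ord f(u) ≥ k`, for a non-degenerate `f`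
with `n` zeros over a residue field with `Q` elements. -/
def levelMass (Q n : ℕ) : ℕ → ℝ
  | 0 => (1 - (Q : ℝ)⁻¹) ^ 2
  | k + 1 => n * (Q : ℝ) ^ (-(k + 2) : ℤ)

variable {Q n : ℕ}

theorem levelMass_nonneg (k : ℕ) : 0 ≤ levelMass Q n k := by
  cases k <;> simp only [levelMass] <;> positivity

/-- The crude bound `n ≤ Q²` gives one estimate valid for all faces, which is used both for
summability and to see that the zeros of `f` are null. -/
theorem levelMass_le (hQ : 1 < Q) (hn : n ≤ Q ^ 2) (k : ℕ) :
    levelMass Q n k ≤ Q * (Q : ℝ)⁻¹ ^ k := by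
  have hQ1 : (1 : ℝ) < Q := by exact_mod_cast hQ
  cases k with
  | zero =>
    have h1 : (Q : ℝ)⁻¹ ≤ 1 := inv_le_one_of_one_le₀ hQ1.le
    have h2 : 0 ≤ (Q : ℝ)⁻¹ := by positivity
    simp only [levelMass, pow_zero, mul_one]
    nlinarith
  | succ k =>
    have h : (n : ℝ) ≤ (Q : ℝ) ^ 2 := by exact_mod_cast hn
    have h3 : (Q : ℝ) ^ (-(k + 2) : ℤ) = (Q : ℝ)⁻¹ ^ (k + 2) := by
      rw [zpow_neg, inv_pow, ← zpow_natCast]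
      push_cast
      rfl
    rw [levelMass, h3]
    refine (mul_le_mul_of_nonneg_right h (by positivity)).trans_eq ?_
    rw [pow_succ _ (k + 1)]
    field_simp

theorem norm_shell_term_le (hQ : 1 < Q) (hn : n ≤ Q ^ 2) (z : ℂ) (k : ℕ) :
    ‖((levelMass Q n k - levelMass Q n (k + 1) : ℝ) : ℂ) * z ^ k‖ ≤
      2 * Q * (‖z‖ / Q) ^ k := by
  have hQ1 : (1 : ℝ) < Q := by exact_mod_cast hQ
  have h1 := levelMass_le hQ hn k
  have h2 := levelMass_le hQ hn (k + 1)
  have h3 : (Q : ℝ) * (Q : ℝ)⁻¹ ^ (k + 1) ≤ Q * (Q : ℝ)⁻¹ ^ k :=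
    mul_le_mul_of_nonneg_left (pow_le_pow_of_le_one (by positivity)
      (inv_le_one_of_one_le₀ hQ1.le) (Nat.le_succ k)) (by positivity)
  have h4 : |levelMass Q n k - levelMass Q n (k + 1)| ≤ 2 * Q * (Q : ℝ)⁻¹ ^ k := by
    have h5 := levelMass_nonneg (Q := Q) (n := n) k
    have h6 := levelMass_nonneg (Q := Q) (n := n) (k + 1)
    rw [abs_le]
    constructor <;> linarith
  rw [norm_mul, norm_pow, Complex.norm_real, Real.norm_eq_abs, div_eq_inv_mul, mul_pow, ← mul_assoc]
  exact mul_le_mul_of_nonneg_right h4 (by positivity)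

theorem hasSum_shell_terms (hQ : 1 < Q) {z : ℂ} (hz : ‖z‖ < Q) :
    HasSum (fun k => ((levelMass Q n k - levelMass Q n (k + 1) : ℝ) : ℂ) * z ^ k)
      ((Q : ℂ) ^ (-2 : ℤ) * (((Q : ℂ) - 1) ^ 2 - (n : ℂ) * (1 - z) / (1 - z / Q))) := by
  have hQ0 : (Q : ℂ) ≠ 0 := by
    norm_cast
    lia
  have hQ1 : (0 : ℝ) < Q := by
    norm_cast
    lia
  have hw : ‖z / Q‖ < 1 := by
    rw [norm_div, Complex.norm_natCast, div_lt_one hQ1]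
    exact hz
  have hw1 : 1 - z / Q ≠ 0 := by
    intro h
    rw [sub_eq_zero] at h
    rw [← h] at hw
    simp at hw
  -- Only the term `k = 0` deviates from a geometric progression of ratio `z / Q`; it is split off.
  rw [← hasSum_nat_add_iff' 1]
  have h := ((hasSum_geometric_of_norm_lt_one hw).mul_left
    ((n : ℂ) * (1 - (Q : ℂ)⁻¹) * (Q : ℂ)⁻¹ * (z / Q)))
  have hterm : ∀ k : ℕ,
      ((levelMass Q n (k + 1) - levelMass Q n (k + 1 + 1) : ℝ) : ℂ) * z ^ (k + 1) =
        (n : ℂ) * (1 - (Q : ℂ)⁻¹) * (Q : ℂ)⁻¹ * (z / Q) * (z / Q) ^ k := fun k => by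
    simp only [levelMass]
    push_cast
    rw [zpow_neg, zpow_neg, show (k + 2 : ℤ) = ((k + 2 : ℕ) : ℤ) by push_cast; rfl,
      show (k + 1 + 2 : ℤ) = ((k + 3 : ℕ) : ℤ) by push_cast; ring, zpow_natCast, zpow_natCast,
      div_pow]
    field_simp
    ring
  have hvalue : (Q : ℂ) ^ (-2 : ℤ) * (((Q : ℂ) - 1) ^ 2 - (n : ℂ) * (1 - z) / (1 - z / Q)) -
      ∑ i ∈ Finset.range 1, ((levelMass Q n i - levelMass Q n (i + 1) : ℝ) : ℂ) * z ^ i =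
        (n : ℂ) * (1 - (Q : ℂ)⁻¹) * (Q : ℂ)⁻¹ * (z / Q) * (1 - z / Q)⁻¹ := by
    have h3 : (Q : ℂ) - z ≠ 0 := by
      intro h
      apply hw1
      rw [sub_eq_zero] at h ⊢
      rw [← h, div_self hQ0]
    rw [Finset.sum_range_one]
    simp only [levelMass]
    push_cast
    rw [show (-2 : ℤ) = -((2 : ℕ) : ℤ) by norm_num,
      zpow_neg, zpow_natCast]
    field_simp
    ring
  rw [hvalue]
  exact h.congr_fun hterm

end ShellSeries

/-! ### Decomposition of the domain into shells -/

section Shells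

variable {K : Type*} [Field K] [ValuativeRel K] [TopologicalSpace K]
  [IsNonarchimedeanLocalField K] (f : 𝒪[K][ℤ × ℤ])

/-- The points of order `a` at which `f` has order exactly `d(a) + k`. -/
def shell (a : ℤ × ℤ) (k : ℕ) : Set (K × K) :=
  {x | val K x.1 = WithZero.exp (-a.1) ∧ val K x.2 = WithZero.exp (-a.2) ∧
    val K (polyFun f x) = WithZero.exp (-(intDist f a + k))}

variable {f}

theorem shell_eq_sdiff (a : ℤ × ℤ) (k : ℕ) :
    shell f a k = levelSet f a k \ levelSet f a (k + 1) := by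
  ext x
  simp only [shell, levelSet, Set.mem_sdiff, Set.mem_ofPred_eq]
  have : val K (polyFun f x) = WithZero.exp (-(intDist f a + k)) ↔
      val K (polyFun f x) ≤ WithZero.exp (-(intDist f a + k)) ∧
      ¬ val K (polyFun f x) ≤ WithZero.exp (-(intDist f a + (k + 1))) := by
    rw [show -(intDist f a + ((k : ℤ) + 1)) = -(intDist f a + k) - 1 by ring, ← lt_exp_iff_le,
      not_lt]
    exact ⟨fun h => ⟨h.le, h.ge⟩, fun h => le_antisymm h.1 h.2⟩
  rw [this]
  tauto

theorem ord_eq_of_val_eq_exp {y : K} {n : ℤ} (h : val K y = WithZero.exp (-n)) : ord y = n := by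
  have := val_eq_exp (ne_zero_of_val_eq_exp h)
  rw [h, WithZero.exp_inj] at this
  lia

theorem integrand_of_mem_shell (h0 : f.coeff.support.Nonempty) (s : ℂ) {a : ℤ × ℤ} {k : ℕ}
    {x : K × K} (hx : x ∈ shell f a k) : integrand f s x =
      (q K : ℂ) ^ (-((dist (newton f) (toReal a) : ℂ) * s)) * ((q K : ℂ) ^ (-s)) ^ k := by
  have hq : (q K : ℂ) ≠ 0 := by
    have := one_lt_q (K := K)
    norm_cast
    lia
  rw [integrand, eval_map_subtype, absK, if_neg (ne_zero_of_val_eq_exp hx.2.2),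
    ord_eq_of_val_eq_exp hx.2.2, ← intDist_cast h0, ← Complex.cpow_nat_mul,
    ← Complex.cpow_add _ _ hq, Complex.cpow_def_of_ne_zero, Complex.cpow_def_of_ne_zero hq,
    ← Complex.ofReal_log (by positivity), Real.log_zpow, ← Complex.ofReal_natCast (q K),
    ← Complex.ofReal_log (Nat.cast_nonneg _)]
  · congr 1
    push_cast
    ring
  · have := q_pos (K := K)
    norm_cast
    positivity

theorem disjoint_shell {a b : ℤ × ℤ} {j k : ℕ} (h : (a, j) ≠ (b, k)) :
    Disjoint (shell f a j) (shell f b k) := by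
  rw [Set.disjoint_left]
  rintro x ⟨h1, h2, h3⟩ ⟨h1', h2', h3'⟩
  rw [h1, WithZero.exp_inj, neg_inj] at h1'
  rw [h2, WithZero.exp_inj, neg_inj] at h2'
  have hab : a = b := Prod.ext h1' h2'
  subst hab
  rw [h3, WithZero.exp_inj, neg_inj, add_right_inj, Nat.cast_inj] at h3'
  exact h (by rw [h3'])

theorem N_le (τ : Set (ℝ × ℝ)) : N f τ ≤ q K ^ 2 := by
  rw [N, q_eq_natCard, pow_two, ← Nat.card_prod]
  exact Nat.card_le_card_of_injective _ Subtype.val_injective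

variable [MeasurableSpace K] [BorelSpace K] {μ : Measure K} [μ.IsAddHaarMeasure]

theorem measure_levelSet_eq (h0 : f.coeff.support.Nonempty) (hf : NonDegenerate f)
    (hμ : μ (𝒪[K] : Set K) = 1) (a : ℤ × ℤ) (k : ℕ) : (μ.prod μ) (levelSet f a k) =
      ENNReal.ofReal ((q K : ℝ) ^ (-weight a) *
        levelMass (q K) (N f (meetLocus (newton f) (toReal a))) k) := by
  cases k with
  | zero => exact measure_levelSet_zero h0 hμ a
  | succ k =>
    push_cast
    exact measure_levelSet_succ h0 hf hμ a k

theorem measurableSet_shell (a : ℤ × ℤ) (k : ℕ) : MeasurableSet (shell f a k) := by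
  rw [shell_eq_sdiff]
  exact (measurableSet_levelSet _ _).diff (measurableSet_levelSet _ _)

theorem measure_shell_ne_top (h0 : f.coeff.support.Nonempty) (hf : NonDegenerate f)
    (hμ : μ (𝒪[K] : Set K) = 1) (a : ℤ × ℤ) (k : ℕ) : (μ.prod μ) (shell f a k) ≠ ⊤ := by
  rw [shell_eq_sdiff]
  refine ne_top_of_le_ne_top ?_ (measure_mono Set.sdiff_subset)
  rw [measure_levelSet_eq h0 hf hμ]
  exact ENNReal.ofReal_ne_top

theorem measureReal_shell (h0 : f.coeff.support.Nonempty) (hf : NonDegenerate f)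
    (hμ : μ (𝒪[K] : Set K) = 1) (a : ℤ × ℤ) (k : ℕ) : (μ.prod μ).real (shell f a k) =
      (q K : ℝ) ^ (-weight a) *
        (levelMass (q K) (N f (meetLocus (newton f) (toReal a))) k -
          levelMass (q K) (N f (meetLocus (newton f) (toReal a))) (k + 1)) := by
  have h1 : ∀ j : ℕ, (μ.prod μ).real (levelSet f a j) = (q K : ℝ) ^ (-weight a) *
      levelMass (q K) (N f (meetLocus (newton f) (toReal a))) j := fun j => by
    rw [Measure.real, measure_levelSet_eq h0 hf hμ, ENNReal.toReal_ofReal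
      (mul_nonneg (by positivity) (levelMass_nonneg j))]
  have h2 := h1 (k + 1)
  push_cast at h2
  rw [shell_eq_sdiff, measureReal_sdiff (levelSet_antitone a (by lia)) (measurableSet_levelSet _ _)
    (by rw [measure_levelSet_eq h0 hf hμ]; exact ENNReal.ofReal_ne_top), h1, h2, mul_sub]

/-- The integral over a shell. -/
theorem setIntegral_shell (h0 : f.coeff.support.Nonempty) (hf : NonDegenerate f)
    (hμ : μ (𝒪[K] : Set K) = 1) (s : ℂ) (a : ℤ × ℤ) (k : ℕ) :
    ∫ x in shell f a k, integrand f s x ∂(μ.prod μ) =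
      (q K : ℂ) ^ (-expo (newton f) s a) *
        (((levelMass (q K) (N f (meetLocus (newton f) (toReal a))) k -
          levelMass (q K) (N f (meetLocus (newton f) (toReal a))) (k + 1) : ℝ) : ℂ) *
            ((q K : ℂ) ^ (-s)) ^ k) := by
  have hq : (q K : ℂ) ≠ 0 := by
    have := one_lt_q (K := K)
    norm_cast
    lia
  rw [setIntegral_congr_fun (measurableSet_shell a k)
    (fun x hx => integrand_of_mem_shell h0 s hx), setIntegral_const, measureReal_shell h0 hf hμ,
    Complex.real_smul, expo, neg_add, Complex.cpow_add _ _ hq, Complex.ofReal_mul,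
    ← Int.cast_neg, Complex.cpow_intCast]
  push_cast
  ring

theorem integrableOn_shell (h0 : f.coeff.support.Nonempty) (hf : NonDegenerate f)
    (hμ : μ (𝒪[K] : Set K) = 1) (s : ℂ) (a : ℤ × ℤ) (k : ℕ) :
    IntegrableOn (integrand f s) (shell f a k) (μ.prod μ) := by
  refine IntegrableOn.congr_fun ?_ (fun x hx => (integrand_of_mem_shell h0 s hx).symm)
    (measurableSet_shell a k)
  exact integrableOn_const (measure_shell_ne_top h0 hf hμ a k)

omit [μ.IsAddHaarMeasure] in
-- The integrand is constant on a shell, so nothing is lost by taking the norm after integrating.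
-- Absolute convergence thus reduces to summability of the norms of the shell integrals.
theorem setIntegral_norm_shell (h0 : f.coeff.support.Nonempty) (s : ℂ) (a : ℤ × ℤ) (k : ℕ) :
    ∫ x in shell f a k, ‖integrand f s x‖ ∂(μ.prod μ) =
      ‖∫ x in shell f a k, integrand f s x ∂(μ.prod μ)‖ := by
  rw [setIntegral_congr_fun (measurableSet_shell a k)
      (fun x hx => integrand_of_mem_shell h0 s hx),
    setIntegral_congr_fun (g := fun _ => ‖(q K : ℂ) ^ (-((dist (newton f) (toReal a) : ℂ) * s)) *
      ((q K : ℂ) ^ (-s)) ^ k‖) (measurableSet_shell a k)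
      (fun x hx => congrArg norm (integrand_of_mem_shell h0 s hx)), setIntegral_const,
    setIntegral_const, norm_smul, smul_eq_mul, Real.norm_of_nonneg measureReal_nonneg]

/-- The zeros of `f` of given order form a null set. -/
theorem measure_zeros (h0 : f.coeff.support.Nonempty) (hf : NonDegenerate f)
    (hμ : μ (𝒪[K] : Set K) = 1) (a : ℤ × ℤ) :
    (μ.prod μ) {x | val K x.1 = WithZero.exp (-a.1) ∧ val K x.2 = WithZero.exp (-a.2) ∧
      polyFun f x = 0} = 0 := by
  -- A zero lies in every level set, and the measures of these decay geometrically.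
  have h : ∀ k : ℕ, (μ.prod μ) {x | val K x.1 = WithZero.exp (-a.1) ∧
      val K x.2 = WithZero.exp (-a.2) ∧ polyFun f x = 0} ≤ ENNReal.ofReal
        ((q K : ℝ) ^ (-weight a) * (q K * (q K : ℝ)⁻¹ ^ k)) := fun k => by
    refine (measure_mono (t := levelSet f a k) ?_).trans ?_
    · rintro x ⟨h1, h2, h3⟩
      exact ⟨h1, h2, by simp [h3]⟩
    · rw [measure_levelSet_eq h0 hf hμ]
      exact ENNReal.ofReal_le_ofReal (mul_le_mul_of_nonneg_left
        (levelMass_le one_lt_q (N_le _) k) (by positivity))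
  have h1 : Filter.Tendsto (fun k : ℕ => (q K : ℝ) ^ (-weight a) * (q K * (q K : ℝ)⁻¹ ^ k))
      Filter.atTop (nhds ((q K : ℝ) ^ (-weight a) * (q K * 0))) :=
    ((tendsto_pow_atTop_nhds_zero_of_lt_one (by positivity)
      (inv_lt_one_of_one_lt₀ (by exact_mod_cast one_lt_q))).const_mul _).const_mul _
  refine le_antisymm (ge_of_tendsto' (by simpa using ENNReal.tendsto_ofReal h1) h) zero_le

/-- Up to a null set, the domain of integration is the disjoint union of the shells. -/
theorem integralTorus_ae_eq (h0 : f.coeff.support.Nonempty) (hf : NonDegenerate f)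
    (hμ : μ (𝒪[K] : Set K) = 1) :
    (⋃ i : {a : ℤ × ℤ // 0 ≤ a.1 ∧ 0 ≤ a.2} × ℕ, shell f i.1 i.2) =ᵐ[μ.prod μ]
      integralTorus K := by
  rw [ae_eq_set]
  constructor
  · convert measure_empty (μ := μ.prod μ)
    rw [Set.sdiff_eq_empty]
    refine Set.iUnion_subset ?_
    rintro ⟨⟨a, ha1, ha2⟩, k⟩ x ⟨h1, h2, _⟩
    refine ⟨val_le_one_iff.1 ?_, val_le_one_iff.1 ?_, ne_zero_of_val_eq_exp h1,
      ne_zero_of_val_eq_exp h2⟩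
    · rw [h1, ← WithZero.exp_zero, WithZero.exp_le_exp]
      lia
    · rw [h2, ← WithZero.exp_zero, WithZero.exp_le_exp]
      lia
  · refine measure_mono_null (t := ⋃ a : ℤ × ℤ, {x | val K x.1 = WithZero.exp (-a.1) ∧
      val K x.2 = WithZero.exp (-a.2) ∧ polyFun f x = 0}) ?_
      (measure_iUnion_null fun a => measure_zeros h0 hf hμ a)
    rintro x ⟨⟨hx1, hx2, hn1, hn2⟩, hx⟩
    have h1 := val_eq_exp hn1
    have h2 := val_eq_exp hn2
    refine Set.mem_iUnion.2 ⟨(ord x.1, ord x.2), h1, h2, ?_⟩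
    by_contra hF
    rw [← val_le_one_iff, h1, ← WithZero.exp_zero, WithZero.exp_le_exp] at hx1
    rw [← val_le_one_iff, h2, ← WithZero.exp_zero, WithZero.exp_le_exp] at hx2
    -- The order of `f(x)` is at least `d` of the order vector, so the `toNat` below is exact.
    have h3 := (mem_levelSet_zero (f := f) (a := (ord x.1, ord x.2)) h0 h1 h2).2.2
    rw [val_eq_exp hF, WithZero.exp_le_exp] at h3
    refine hx (Set.mem_iUnion.2 ⟨(⟨(ord x.1, ord x.2), by simp; lia⟩,
      (ord (polyFun f x) - intDist f (ord x.1, ord x.2)).toNat), h1, h2, ?_⟩)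
    rw [val_eq_exp hF, WithZero.exp_inj]
    lia

end Shells

/-! ### Summation along the subdivision -/

section Subdivision

/-- A sum over the lattice points of the quadrant, split along a subdivision. -/
theorem IsSubdivision.hasSum_quadrant {M : Type*} [AddCommGroup M] [TopologicalSpace M]
    [IsTopologicalAddGroup M] {Γ : Set (ℝ × ℝ)} {D : Finset (Finset (ℤ × ℤ))}
    (hD : IsSubdivision Γ D) {Ψ : ℤ × ℤ → M} {v : Finset (ℤ × ℤ) → M}
    (h : ∀ g ∈ D, HasSum (fun a : {a : ℤ × ℤ // toReal a ∈ openCone g} => Ψ a) (v g)) :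
    HasSum (fun a : {a : ℤ × ℤ // 0 ≤ a.1 ∧ 0 ≤ a.2} => Ψ a) (Ψ 0 + ∑ g ∈ D, v g) := by
  classical
  have h1 := hasSum_sum fun g hg =>
    (hasSum_subtype_iff_indicator (s := {a : ℤ × ℤ | toReal a ∈ openCone g})).1 (h g hg)
  -- The origin lies in no cone and is added as a separate term.
  have h2 : HasSum (fun a : ℤ × ℤ => if a = 0 then Ψ 0 else 0) (Ψ 0) := hasSum_ite_eq 0 (Ψ 0)
  refine (hasSum_subtype_iff_indicator (s := {a : ℤ × ℤ | 0 ≤ a.1 ∧ 0 ≤ a.2})).2 ((h2.add h1).congr_fun fun a => ?_)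
  have hquad : toReal a ∈ quadrant ↔ 0 ≤ a.1 ∧ 0 ≤ a.2 := by
    simp [quadrant, toReal]
  by_cases ha0 : a = 0
  · subst ha0
    rw [Finset.sum_eq_zero, Set.indicator_of_mem (by simp), if_pos rfl, add_zero]
    intro g hg
    refine Set.indicator_of_notMem (fun h0 => ?_) _
    exact (hD.subset g hg h0).2 (by simp [toReal])
  · rw [if_neg ha0, zero_add]
    by_cases ha : 0 ≤ a.1 ∧ 0 ≤ a.2
    · have hne : toReal a ≠ 0 := fun h0 => ha0 (toReal_injective (by simpa [toReal] using h0))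
      obtain ⟨g, hg, hag⟩ := hD.cover (toReal a) ⟨hquad.2 ha, hne⟩
      rw [Set.indicator_of_mem (by exact ha), Finset.sum_eq_single_of_mem g hg,
        Set.indicator_of_mem (by exact hag)]
      intro g' hg' hne'
      refine Set.indicator_of_notMem (fun h' => ?_) _
      exact Set.disjoint_left.1 (hD.disjoint g' hg' g hg hne') h' hag
    · rw [Set.indicator_of_notMem (by exact ha), Finset.sum_eq_zero]
      intro g hg
      refine Set.indicator_of_notMem (fun h' => ha (hquad.1 ?_)) _
      exact (hD.subset g hg h').1

variable {T : Finset (ℤ × ℤ)} {D : Finset (Finset (ℤ × ℤ))} {s : ℂ}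

/-- The sign of `d(a)` decides which bound is active: `α` for negative, `β` for positive. For `d(a)
= 0` positivity of the weight suffices. -/
theorem expo_re_pos {Γ : Set (ℝ × ℝ)} (hD : IsSubdivision Γ D) (hβ : beta Γ D < (s.re : EReal))
    (hα : (s.re : EReal) < alpha Γ D) {g : Finset (ℤ × ℤ)} (hg : g ∈ D) {a : ℤ × ℤ} (ha : a ∈ g) :
    0 < (expo Γ s a).re := by
  have hw : (0 : ℝ) < weight a := by
    have := weight_pos (hD.simplicial g hg) (hD.subset g hg) ha
    exact_mod_cast this
  have hre : (expo Γ s a).re = weight a + dist Γ (toReal a) * s.re := by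
    simp [expo]
  rw [hre]
  rcases lt_trichotomy (dist Γ (toReal a)) 0 with hd | hd | hd
  · have h1 : alpha Γ D ≤ (((weight a : ℝ) / (-dist Γ (toReal a)) : ℝ) : EReal) :=
      (iInf₂_le g hg).trans ((iInf₂_le a ha).trans (iInf_le _ hd))
    have h2 := hα.trans_le h1
    rw [EReal.coe_lt_coe_iff, lt_div_iff₀ (by linarith)] at h2
    linarith
  · rw [hd]
    simpa using hw
  · have h1 : (((weight a : ℝ) / (-dist Γ (toReal a)) : ℝ) : EReal) ≤ beta Γ D :=
      le_max_of_le_right ((le_iSup (fun _ : 0 < dist Γ (toReal a) =>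
        (((weight a : ℝ) / (-dist Γ (toReal a)) : ℝ) : EReal)) hd).trans
          ((le_iSup₂ (f := fun a (_ : a ∈ g) => ⨆ _ : 0 < dist Γ (toReal a),
            (((weight a : ℝ) / (-dist Γ (toReal a)) : ℝ) : EReal)) a ha).trans
            (le_iSup₂ (f := fun g (_ : g ∈ D) => ⨆ a ∈ g, ⨆ _ : 0 < dist Γ (toReal a),
              (((weight a : ℝ) / (-dist Γ (toReal a)) : ℝ) : EReal)) g hg)))
    have h2 := h1.trans_lt hβ
    rw [EReal.coe_lt_coe_iff, div_neg, neg_lt, lt_div_iff₀ hd] at h2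
    linarith

theorem neg_one_lt_re {Γ : Set (ℝ × ℝ)} (hβ : beta Γ D < (s.re : EReal)) : -1 < s.re := by
  have : ((-1 : ℝ) : EReal) < (s.re : EReal) := (le_max_left _ _).trans_lt hβ
  exact_mod_cast this

/-- The sum of `Q ^ (-expo a)` over the lattice points of a cone of the subdivision. -/
theorem hasSum_cone (hT : T.Nonempty)
    (hD : IsSubdivision (convexHull ℝ (toReal '' (T : Set (ℤ × ℤ)))) D)
    (hβ : beta (convexHull ℝ (toReal '' (T : Set (ℤ × ℤ)))) D < (s.re : EReal))
    (hα : (s.re : EReal) < alpha (convexHull ℝ (toReal '' (T : Set (ℤ × ℤ)))) D)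
    {Q : ℕ} (hQ : 1 < Q) {g : Finset (ℤ × ℤ)} (hg : g ∈ D) :
    (Summable fun a : {a : ℤ × ℤ // toReal a ∈ openCone g} =>
      ‖(Q : ℂ) ^ (-expo (convexHull ℝ (toReal '' (T : Set (ℤ × ℤ)))) s a)‖) ∧
    HasSum (fun a : {a : ℤ × ℤ // toReal a ∈ openCone g} =>
      (Q : ℂ) ^ (-expo (convexHull ℝ (toReal '' (T : Set (ℤ × ℤ)))) s a))
      (coneSum (convexHull ℝ (toReal '' (T : Set (ℤ × ℤ)))) Q s g) := by
  classical
  obtain ⟨τ, -, hτ⟩ := hD.subordinated g hg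
  obtain ⟨l, hl, hlin⟩ := exists_dist_eq_pair_on_cone T hT hτ
  set Γ := convexHull ℝ (toReal '' (T : Set (ℤ × ℤ))) with hΓ
  -- The exponent is not additive on all of `ℤ × ℤ`. Replacing `d` by the pairing with `l` gives an
  -- additive map that agrees with it on the closed cone, where all the relevant points lie.
  let E : ℤ × ℤ →+ ℂ :=
    { toFun := fun a => (weight a : ℂ) + ((pair (toReal a) (toReal l) : ℝ) : ℂ) * s
      map_zero' := by simp [weight, pair, toReal]
      map_add' := fun a b => by
        rw [toReal_add, pair_add_left]
        simp only [weight, Prod.fst_add, Prod.snd_add]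
        push_cast
        ring }
  have hE : ∀ a : ℤ × ℤ, (∃ c : ℤ × ℤ → ℝ, (∀ b ∈ g, 0 ≤ c b) ∧
      toReal a = ∑ b ∈ g, c b • toReal b) → expo Γ s a = E a := by
    rintro a ⟨c, hc, he⟩
    have := hlin c hc
    rw [← he] at this
    simp only [expo, this]
    rfl
  have hcone : ∀ a : ℤ × ℤ, toReal a ∈ openCone g → expo Γ s a = E a := by
    rintro a ⟨c, hc, he⟩
    exact hE a ⟨c, fun b hb => (hc b hb).le, he⟩
  have hlattice : ∀ a ∈ latticePoints g, expo Γ s a = E a := by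
    rintro a ⟨c, hc, he⟩
    exact hE a ⟨c, fun b hb => (hc b hb).1, he⟩
  have hedge : ∀ a ∈ g, expo Γ s a = E a := by
    intro a ha
    refine hE a ⟨fun b => if b = a then 1 else 0, fun b _ => by positivity, ?_⟩
    rw [Finset.sum_eq_single a (fun b _ hb => by simp [hb]) (fun h => absurd ha h)]
    simp
  obtain ⟨h1, h2⟩ := hasSum_conePoints (hD.simplicial g hg) E hQ fun a ha => by
    rw [← hedge a ha]
    exact expo_re_pos hD hβ hα hg ha
  have hval : coneSum Γ Q s g = ((∑ᶠ h ∈ latticePoints g, (Q : ℂ) ^ E h) *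
      (Q : ℂ) ^ (-∑ a ∈ g, E a)) / ∏ a ∈ g, (1 - (Q : ℂ) ^ (-E a)) := by
    rw [coneSum, finsum_mem_congr rfl fun h hh => by rw [hlattice h hh],
      Finset.sum_congr rfl hedge, Finset.prod_congr rfl fun a ha => by rw [hedge a ha]]
  rw [hval]
  exact ⟨h1.congr fun a => by rw [hcone a a.2], h2.congr_fun fun a => by rw [hcone a a.2]⟩

/-- Sums over attainable faces of sums over the cones that lie in the cone of the face. -/
theorem finsum_attainable {Γ : Set (ℝ × ℝ)} (Q : ℕ)
    (w : Set (ℝ × ℝ) → ℂ) {τ : Finset (ℤ × ℤ) → Set (ℝ × ℝ)}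
    (hτ : ∀ g ∈ D, τ g ∈ attainable Γ ∧ openCone g ⊆ faceCone Γ (τ g)) :
    ∑ᶠ t ∈ attainable Γ, w t * S Γ D Q s t = ∑ g ∈ D, coneSum Γ Q s g * w (τ g) := by
  classical
  -- An open cone is never empty, so it determines the face in whose cone it lies.
  have huniq : ∀ g ∈ D, ∀ t, openCone g ⊆ faceCone Γ t ↔ τ g = t := by
    intro g hg t
    refine ⟨fun h => ?_, fun h => h ▸ (hτ g hg).2⟩
    have hb : ∑ a ∈ g, (1 : ℝ) • toReal a ∈ openCone g := ⟨fun _ => 1, by simp, rfl⟩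
    exact ((hτ g hg).2 hb).symm.trans (h hb)
  have hS : ∀ t, S Γ D Q s t = ∑ g ∈ D with τ g = t, coneSum Γ Q s g := fun t => by
    rw [S]
    refine Finset.sum_congr ?_ fun _ _ => rfl
    ext g
    simp only [Finset.mem_filter]
    exact and_congr_right fun hg => huniq g hg t
  -- `S` vanishes at faces that carry no cone of `D`, so the sum has finite support and can be
  -- grouped by the fibres of `τ`.
  rw [finsum_mem_eq_sum_of_subset (t := D.image τ)]
  · rw [← Finset.sum_fiberwise_of_maps_to (g := τ) (t := D.image τ)
      fun g hg => Finset.mem_image_of_mem τ hg]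
    refine Finset.sum_congr rfl fun t _ => ?_
    rw [hS, Finset.mul_sum]
    refine Finset.sum_congr rfl fun g hg => ?_
    rw [(Finset.mem_filter.1 hg).2, mul_comm]
  · rintro t ⟨-, ht⟩
    by_contra hn
    refine ht ?_
    beta_reduce
    rw [hS, Finset.filter_false_of_mem, Finset.sum_empty, mul_zero]
    intro g hg h
    exact hn (by simpa using ⟨g, hg, h⟩)
  · intro t ht
    obtain ⟨g, hg, rfl⟩ := Finset.mem_image.1 (Finset.mem_coe.1 ht)
    exact (hτ g hg).1

end Subdivision

end LaurentZeta

end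

/-! ### Assembly of the formula -/

theorem theorem5p3 {K : Type*} [Field K] [ValuativeRel K] [TopologicalSpace K]
    [IsNonarchimedeanLocalField K] [MeasurableSpace K] [BorelSpace K]
    (μ : MeasureTheory.Measure K) [μ.IsAddHaarMeasure] (hμ : μ (𝒪[K] : Set K) = 1)
    (f : AddMonoidAlgebra 𝒪[K] (ℤ × ℤ))
    (hdim : affineSpan ℝ (LaurentZeta.newton f) = ⊤)
    (hf : LaurentZeta.NonDegenerate f)
    (D : Finset (Finset (ℤ × ℤ))) (hD : LaurentZeta.IsSubdivision (LaurentZeta.newton f) D)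
    (s : ℂ) (hβ : LaurentZeta.beta (LaurentZeta.newton f) D < (s.re : EReal))
    (hα : (s.re : EReal) < LaurentZeta.alpha (LaurentZeta.newton f) D) :
    MeasureTheory.IntegrableOn (LaurentZeta.integrand f s) (LaurentZeta.integralTorus K)
        (μ.prod μ) ∧
      LaurentZeta.zeta μ f s =
        LaurentZeta.L f s (LaurentZeta.newton f) +
          ∑ᶠ τ ∈ LaurentZeta.attainable (LaurentZeta.newton f),
            LaurentZeta.L f s τ *
              LaurentZeta.S (LaurentZeta.newton f) D (LaurentZeta.q K) s τ := by
  open LaurentZeta in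
  -- Full dimension of the polytope excludes `f = 0`.
  have h0 : f.coeff.support.Nonempty := by
    by_contra h
    rw [Finset.not_nonempty_iff_eq_empty] at h
    rw [newton, h] at hdim
    simp at hdim
  have hq := one_lt_q (K := K)
  have hq0 : (q K : ℂ) ≠ 0 := by
    norm_cast
    lia
  have hnorm : ‖(q K : ℂ) ^ (-s)‖ < q K := by
    rw [Complex.norm_natCast_cpow_of_pos (by lia), Complex.neg_re]
    refine (Real.rpow_lt_rpow_of_exponent_lt (z := 1) (by exact_mod_cast hq) ?_).trans_eq
      (Real.rpow_one _)
    linarith [neg_one_lt_re hβ]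
  choose! τ hτ using hD.subordinated
  have hcone := fun g (hg : g ∈ D) => hasSum_cone h0 hD hβ hα hq hg
  have hsum : Summable fun a : {a : ℤ × ℤ // 0 ≤ a.1 ∧ 0 ≤ a.2} =>
      ‖(q K : ℂ) ^ (-expo (newton f) s a)‖ :=
    (hD.hasSum_quadrant (Ψ := fun a => ‖(q K : ℂ) ^ (-expo (newton f) s a)‖)
      fun g hg => (hcone g hg).1.hasSum).summable
  have hshell : ∀ a : ℤ × ℤ, HasSum (fun k => ∫ x in shell f a k, integrand f s x ∂(μ.prod μ))
      ((q K : ℂ) ^ (-expo (newton f) s a) * L f s (meetLocus (newton f) (toReal a))) := by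
    intro a
    have h := (hasSum_shell_terms (n := N f (meetLocus (newton f) (toReal a))) hq
      hnorm).mul_left ((q K : ℂ) ^ (-expo (newton f) s a))
    rw [L, Complex.cpow_sub _ _ hq0, Complex.cpow_one]
    exact h.congr_fun fun k => setIntegral_shell h0 hf hμ s a k
  -- The bound on the shell terms is independent of the face, so the double series is dominated by
  -- the product of the series over order vectors and one geometric series.
  have hsummable : Summable fun i : {a : ℤ × ℤ // 0 ≤ a.1 ∧ 0 ≤ a.2} × ℕ =>
      ‖∫ x in shell f i.1 i.2, integrand f s x ∂(μ.prod μ)‖ := by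
    have hgeom : Summable fun k : ℕ => 2 * (q K : ℝ) * (‖(q K : ℂ) ^ (-s)‖ / q K) ^ k :=
      (summable_geometric_of_lt_one (by positivity) ((div_lt_one q_pos).2 hnorm)).mul_left _
    refine Summable.of_nonneg_of_le (fun _ => norm_nonneg _) (fun i => ?_)
      (hsum.mul_of_nonneg hgeom (fun _ => norm_nonneg _) fun _ => by positivity)
    rw [setIntegral_shell h0 hf hμ, norm_mul]
    exact mul_le_mul_of_nonneg_left (norm_shell_term_le hq (N_le _) _ _) (norm_nonneg _)
  have hint : IntegrableOn (integrand f s)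
      (⋃ i : {a : ℤ × ℤ // 0 ≤ a.1 ∧ 0 ≤ a.2} × ℕ, shell f i.1 i.2) (μ.prod μ) :=
    integrableOn_iUnion_of_summable_integral_norm
      (fun i => integrableOn_shell h0 hf hμ s i.1 i.2)
      (hsummable.congr fun i => (setIntegral_norm_shell h0 s i.1 i.2).symm)
  have hae := integralTorus_ae_eq (μ := μ) h0 hf hμ
  refine ⟨hint.congr_set_ae hae.symm, ?_⟩
  have htotal := (hasSum_integral_iUnion
    (fun i : {a : ℤ × ℤ // 0 ≤ a.1 ∧ 0 ≤ a.2} × ℕ => measurableSet_shell i.1.1 i.2)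
    (fun i j hij => disjoint_shell fun h => hij (by
      rw [Prod.mk.injEq] at h
      exact Prod.ext (Subtype.ext h.1) h.2)) hint).prod_fiberwise fun a => hshell a
  rw [setIntegral_congr_set hae] at htotal
  have hquad := hD.hasSum_quadrant (v := fun g => coneSum (newton f) (q K) s g * L f s (τ g))
    (Ψ := fun a => (q K : ℂ) ^ (-expo (newton f) s a) *
      L f s (meetLocus (newton f) (toReal a))) fun g hg =>
        ((hcone g hg).2.mul_right _).congr_fun fun a => by
          rw [(hτ g hg).2 a.2]
          rfl
  rw [zeta, htotal.unique hquad, finsum_attainable (q K) (L f s) hτ]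
  -- It remains to identify the term at the origin, whose meet locus is the whole polytope and whose
  -- exponent is zero.
  have hd0 : dist (newton f) (toReal 0) = 0 := by
    obtain ⟨l, -, h, -⟩ := exists_dist_eq_pair f.coeff.support h0 (toReal 0)
    rw [newton, h]
    simp [pair, toReal]
  have hm0 : meetLocus (newton f) (toReal 0) = newton f := by
    ext x
    simp only [meetLocus, hd0, Set.mem_ofPred_eq, pair]
    simp [toReal]
  have he0 : expo (newton f) s 0 = 0 := by
    simp [expo, hd0, weight]
  rw [hm0, he0, neg_zero, Complex.cpow_zero, one_mul]
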